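/- **Setting.** Let $k\in\mathbb N$ and let $\Lambda$ be a finite $k$-graph with degree map $d$, range and source maps $r,s$ and vertex set $\Lambda^0$: a countable category $\Lambda$ with a degree functor $d:\Lambda\to\mathbb N^k$ satisfying the factorisation property, with $\Lambda^n:=d^{-1}(n)$ finite for every $n\in\mathbb N^k$. Suppose that $\Lambda$ has no sources and no sinks: $v\Lambda^n\neq\emptyset\neq\Lambda^nv$ for all $v\in\Lambda^0$, $n\in\mathbb N^k$. For $C,D\subseteq\Lambda^0$ and $E\subseteq \Lambda$ write $CED=\{\lambda\in E: r(\lambda)\in C,\ s(\lambda)\in D\}$, let $A_i(v,w)=|v\Lambda^{e_i}w|$ be the vertex matrices, let $A_{C,i}$ be the $C\times C$ block of $A_i$, and let $\rho$ denote the spectral radius. Let $\mathcal C$ be the set of nontrivial strongly connected components, i.e. the equivalence classes for the relation $v\sim w\iff v\Lambda w\ne\emptyset\ne w\Lambda v$ that are not of the form $\{v\}$ with $v\Lambda v=\{v\}$. A set $X\subseteq \Lambda^0$ is hereditary if $v\in X$ and $v\Lambda w\neq\emptyset$ imply $w\in X$; then $\Lambda\setminus X:=\{\lambda\in\Lambda:s(\lambda)\notin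 X\}$ is a $k$-graph. Assume: * (A1) there are no trivial strongly connected components, and there are no disjoint non-empty sets $K,H'\subseteq\Lambda^0$ with $\Lambda=K\Lambda K\sqcup H'\Lambda H'$; * (A2) for all $C\in\mathcal C$ and $1\le i\le k$, $A_{C,i}$ is irreducible and $\rho(A_{C,i})>1$; * (A3) if $C,D\in\mathcal C$ and $C\Lambda^{e_j}D\neq\emptyset$ for some $j$, then $C\Lambda^{e_i}D\ne\emptyset$ for all $1\le i\le k$. Let $r=(r_1,\dots,r_k)\in(0,\infty)^k$ have rationally independent coordinates and satisfy $\max_i r_i^{-1}\ln\rho(A_i)=1$. Call $C\in\mathcal C$ *critical* (for $\Lambda$ and $r$) if there is $j$ with $r_j^{-1}\ln\rho(A_j)=1$, $r_j=\ln\rho(A_{C,j})$ and $A_{C,j}$ irreducible. Order components by $C\le D\iff C\Lambda D\neq\emptyset$, let $M$ be the union of the minimal elements of the set of critical components, and let $H:=\overline{M}\setminus M$, where $\overline M$ is the hereditary closure of $M$ (the smallest hereditary set that contains $M$). The set $H$ is hereditary; let $G$ be the union of the critical components of $\Lambda\setminus H$ (for the same $r$). Let $\mathcal TC^*(\Lambda)$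 be the $C^*$-algebra generated by a universal Toeplitz–Cuntz–Krieger $\Lambda$-family $\{t_\lambda:\lambda\in\Lambda\}$, let $q_v:=t_v$ for $v\in\Lambda^0$, and let $\alpha^r:\mathbb R\to\operatorname{Aut}\mathcal TC^*(\Lambda)$ be the dynamics with $\alpha^r_t(t_\lambda)=e^{it\,r\cdot d(\lambda)}t_\lambda$ (and likewise for other finite $k$-graphs). A KMS$_\beta$ state is a state $\phi$ with $\phi(ab)=\phi(b\,\alpha^r_{i\beta}(a))$ for all analytic elements $a,b$. **Lemma.** The set $H\cup G$ is hereditary in $\Lambda$. Let $\beta<1$ be real (in particular, $\beta$ may be any inverse temperature in $(0,1)$), and let $\phi$ be a KMS$_\beta$ state of $(\mathcal TC^*(\Lambda),\alpha^r)$. Then $\phi(q_v)=0$ for all $v\in H\cup G$, and $\phi$ factors through a KMS$_\beta$ state of $(\mathcal TC^*(\Lambda\setminus(H\cup G)),\alpha^r)$: there is a KMS$_\beta$ state $\psi$ of that system with $\phi=\psi\circ\pi$, where $\pi:\mathcal TC^*(\Lambda)\to\mathcal TC^*(\Lambda\setminus(H\cup G))$ is the canonical homomorphism with $\pi(t_\lambda)=t_\lambda$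 if $s(\lambda)\notin H\cup G$ and $\pi(t_\lambda)=0$ otherwise. (If $H\cup G=\Lambda^0$, this says that there are no KMS$_\beta$ states.) -/

import Mathlib

open CategoryTheory
open scoped ENNReal ComplexOrder CStarAlgebra

universe u v

noncomputable section

/-! ### Finite higher-rank graphs -/

/-- A finite `k`-graph `Λ` whose vertices are the objects of the category `V` and whose paths are
its morphisms: a path `f : w ⟶ v` has source `w` and range `v`, and the product `f g` of paths with
`s(f) = r(g)` is the composite `g ≫ f`. The degree is additive on composites and has the
unique factorisation property. (By unique factorisation the paths of degree `0` are exactly the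
identities, so `Λ⁰` is `V`; with finitely many vertices and paths of each degree, the category is
automatically countable.) -/
structure FinKGraph (k : ℕ) (V : Type u) [Category.{v} V] where
  deg : ∀ ⦃w v : V⦄, (w ⟶ v) → (Fin k → ℕ)
  deg_id : ∀ v : V, deg (𝟙 v) = 0
  deg_comp : ∀ ⦃x w v : V⦄ (g : x ⟶ w) (f : w ⟶ v), deg (g ≫ f) = deg f + deg g
  factorisation : ∀ ⦃w v : V⦄ (l : w ⟶ v) (m n : Fin k → ℕ), deg l = m + n →
    ∃! p : Σ x : V, (x ⟶ v) × (w ⟶ x),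
      deg p.2.1 = m ∧ deg p.2.2 = n ∧ p.2.2 ≫ p.2.1 = l
  finite_vertices : Finite V
  finite_paths : ∀ (v w : V) (n : Fin k → ℕ), Finite {f : w ⟶ v // deg f = n}

/-- The spectral radius of a real square matrix (the largest modulus of a complex eigenvalue). -/
def Matrix.rho {ι : Type*} [Finite ι] (M : Matrix ι ι ℝ) : ℝ :=
  letI := Fintype.ofFinite ι
  letI := Classical.decEq ι
  (spectralRadius ℂ (M.map Complex.ofReal)).toReal

namespace FinKGraph

variable {k : ℕ} {V : Type u} [Category.{v} V] (Λ : FinKGraph k V)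

/-- `v Λⁿ w` -/
def paths (v w : V) (n : Fin k → ℕ) : Set (w ⟶ v) := {f | Λ.deg f = n}

/-- There are no sources and no sinks: `vΛⁿ` and `Λⁿv` are non-empty for all `v` and `n`. -/
def NoSourcesNoSinks : Prop :=
  ∀ (v : V) (n : Fin k → ℕ),
    (∃ w, (Λ.paths v w n).Nonempty) ∧ (∃ w, (Λ.paths w v n).Nonempty)

/-- The vertex matrix `A_i(v, w) = |v Λ^{e_i} w|`. -/
def vertexMatrix (i : Fin k) : Matrix V V ℝ :=
  fun v w => ((Λ.paths v w (Pi.single i 1)).ncard : ℝ)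

/-- The block `A_{C,i}`. -/
def blockMatrix (C : Set V) (i : Fin k) : Matrix C C ℝ :=
  (Λ.vertexMatrix i).submatrix Subtype.val Subtype.val

/-- `ρ(A_i)` -/
def rho (i : Fin k) : ℝ :=
  haveI := Λ.finite_vertices
  (Λ.vertexMatrix i).rho

/-- `ρ(A_{C,i})` -/
def rhoBlock (C : Set V) (i : Fin k) : ℝ :=
  haveI := Λ.finite_vertices
  (Λ.blockMatrix C i).rho

/-! ### Hereditary sets and strongly connected components -/

/-- `C Λ D ≠ ∅` -/
def Leads (_Λ : FinKGraph k V) (C D : Set V) : Prop := ∃ v ∈ C, ∃ w ∈ D, Nonempty (w ⟶ v)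

/-- `C Λ^{e_i} D ≠ ∅` -/
def LeadsEdge (i : Fin k) (C D : Set V) : Prop :=
  ∃ v ∈ C, ∃ w ∈ D, (Λ.paths v w (Pi.single i 1)).Nonempty

/-- `H` is hereditary if `v ∈ H` and `v Λ w ≠ ∅` imply `w ∈ H`. -/
def IsHereditary (_Λ : FinKGraph k V) (H : Set V) : Prop :=
  ∀ ⦃v w : V⦄, v ∈ H → Nonempty (w ⟶ v) → w ∈ H

/-- The hereditary closure: the smallest hereditary set that contains `S`. -/
def hereditaryClosure (_Λ : FinKGraph k V) (S : Set V) : Set V :=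
  {w | ∃ v ∈ S, Nonempty (w ⟶ v)}

/-- `C` is a strongly connected component: a class of the relation
`v ∼ w ↔ v Λ w ≠ ∅ ∧ w Λ v ≠ ∅`. -/
def IsComponent (_Λ : FinKGraph k V) (C : Set V) : Prop :=
  ∃ v : V, C = {w | Nonempty (w ⟶ v) ∧ Nonempty (v ⟶ w)}

/-- `C = {v}` for a vertex with `v Λ v = {v}`. -/
def IsTrivialComponent (_Λ : FinKGraph k V) (C : Set V) : Prop :=
  ∃ v : V, C = {v} ∧ ∀ f : v ⟶ v, f = 𝟙 v

/-- The set of nontrivial strongly connected components. -/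
def components : Set (Set V) := {C | Λ.IsComponent C ∧ ¬ Λ.IsTrivialComponent C}

/-- There are no trivial strongly connected components, and `Λ` is not the disjoint union
`KΛK ⊔ HΛH` for disjoint non-empty sets `K`, `H` of vertices. -/
def A1 : Prop :=
  (∀ C, Λ.IsComponent C → ¬ Λ.IsTrivialComponent C) ∧
  ¬ ∃ K H : Set V, K.Nonempty ∧ H.Nonempty ∧ Disjoint K H ∧
      ∀ (w v : V), Nonempty (w ⟶ v) → (v ∈ K ∧ w ∈ K) ∨ (v ∈ H ∧ w ∈ H)

/-- Every `Λ_C` is coordinatewise irreducible, and `ρ(A_{C,i}) > 1` for all `i`. -/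
def A2 : Prop :=
  ∀ C ∈ Λ.components, (∀ i, (Λ.blockMatrix C i).IsIrreducible) ∧ ∀ i, 1 < Λ.rhoBlock C i

/-- `C Λ^{e_j} D ≠ ∅` for some `j` implies `C Λ^{e_i} D ≠ ∅` for all `i`. -/
def A3 : Prop :=
  ∀ C ∈ Λ.components, ∀ D ∈ Λ.components,
    (∃ j, Λ.LeadsEdge j C D) → ∀ i, Λ.LeadsEdge i C D

/-- The normalisation `max_i r_i⁻¹ ln ρ(A_i) = 1`. -/
def IsNormalised (r : Fin k → ℝ) : Prop :=
  IsGreatest (Set.range fun i => (r i)⁻¹ * Real.log (Λ.rho i)) 1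

/-- `C` is critical: it is a nontrivial component, and for some `j` with
`r_j⁻¹ ln ρ(A_j) = 1` one has `r_j = ln ρ(A_{C,j})` and `A_{C,j}` is irreducible. -/
def IsCritical (r : Fin k → ℝ) (C : Set V) : Prop :=
  C ∈ Λ.components ∧ ∃ j, (r j)⁻¹ * Real.log (Λ.rho j) = 1 ∧
    r j = Real.log (Λ.rhoBlock C j) ∧ (Λ.blockMatrix C j).IsIrreducible

/-- `C` is a minimal critical component for the order `C ≤ D ↔ C Λ D ≠ ∅`. -/
def IsMinCritical (r : Fin k → ℝ) (C : Set V) : Prop :=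
  Λ.IsCritical r C ∧ ∀ D, Λ.IsCritical r D → Λ.Leads D C → D = C

/-- The union of the minimal critical components. -/
def minCritVertices (r : Fin k → ℝ) : Set V := ⋃₀ {C | Λ.IsMinCritical r C}

/-- The set `H`: the hereditary closure of the union of the minimal critical components, with
that union removed. -/
def setH (r : Fin k → ℝ) : Set V :=
  Λ.hereditaryClosure (Λ.minCritVertices r) \ Λ.minCritVertices r

theorem isHereditary_setH (r : Fin k → ℝ) : Λ.IsHereditary (Λ.setH r) := by
  rintro v w ⟨⟨u, ⟨C, hC, huC⟩, ⟨f⟩⟩, hvG⟩ ⟨g⟩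
  refine ⟨⟨u, ⟨C, hC, huC⟩, ⟨g ≫ f⟩⟩, ?_⟩
  rintro ⟨D, hD, hwD⟩
  have hCD : C = D := hD.2 C hC.1 ⟨u, huC, w, hwD, ⟨g ≫ f⟩⟩
  subst hCD
  apply hvG
  refine ⟨C, hC, ?_⟩
  obtain ⟨x, hx⟩ := hC.1.1.1
  rw [hx] at huC hwD ⊢
  obtain ⟨⟨a⟩, _⟩ := huC
  obtain ⟨_, ⟨b⟩⟩ := hwD
  exact ⟨⟨f ≫ a⟩, ⟨b ≫ g⟩⟩

/-! ### Removing a hereditary set -/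

/-- The full subcategory on the vertices outside `H`. -/
abbrev Removed (H : Set V) : Type u := ObjectProperty.FullSubcategory (fun v : V => v ∉ H)

/-- The `k`-graph `Λ \ H` of the paths with source outside the hereditary set `H`; as `H` is
hereditary, their ranges lie outside `H` too. -/
def remove (H : Set V) (hH : Λ.IsHereditary H) : FinKGraph k (Removed H) where
  deg _ _ f := Λ.deg f.hom
  deg_id v := Λ.deg_id v.obj
  deg_comp _ _ _ g f := Λ.deg_comp g.hom f.hom
  factorisation := by
    rintro w v ⟨l⟩ m n h
    obtain ⟨⟨x, f, g⟩, ⟨hm, hn, hl⟩, huniq⟩ := Λ.factorisation l m n h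
    have hx : x ∉ H := fun hx => w.2 (hH hx ⟨g⟩)
    refine ⟨⟨⟨x, hx⟩, ⟨f⟩, ⟨g⟩⟩, ⟨hm, hn, ObjectProperty.hom_ext _ hl⟩, ?_⟩
    rintro ⟨⟨y, hy⟩, ⟨f'⟩, ⟨g'⟩⟩ ⟨hm', hn', hl'⟩
    have := huniq ⟨y, f', g'⟩ ⟨hm', hn', congrArg InducedCategory.Hom.hom hl'⟩
    cases this
    rfl
  finite_vertices := by
    have := Λ.finite_vertices
    refine Finite.of_injective (fun v : Removed H => v.obj) ?_
    rintro ⟨v, _⟩ ⟨w, _⟩ h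
    cases h
    rfl
  finite_paths v w n := by
    have := Λ.finite_paths v.obj w.obj n
    refine Finite.of_injective (fun f : {f : w ⟶ v // Λ.deg f.hom = n} =>
      (⟨f.1.hom, f.2⟩ : {f : w.obj ⟶ v.obj // Λ.deg f = n})) ?_
    rintro ⟨⟨f⟩, _⟩ ⟨⟨g⟩, _⟩ h
    cases h
    rfl

/-- The set `G`: the union of the critical components of `Λ \ H`. -/
def setG (r : Fin k → ℝ) : Set V :=
  ObjectProperty.FullSubcategory.obj '' ⋃₀ {C | (Λ.remove (Λ.setH r) (Λ.isHereditary_setH r)).IsCritical r C}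

/-! ### Toeplitz–Cuntz–Krieger families -/

/-- `Λ^min(f, g)` for paths `f`, `g` with common range: the pairs `(a, b)` with
`f a = g b ∈ Λ^{d(f) ∨ d(g)}`. (It is empty for paths with different ranges.) -/
abbrev MinExt {x y v : V} (f : x ⟶ v) (g : y ⟶ v) : Type _ :=
  {p : Σ z : V, (z ⟶ x) × (z ⟶ y) //
    p.2.1 ≫ f = p.2.2 ≫ g ∧ Λ.deg (p.2.1 ≫ f) = Λ.deg f ⊔ Λ.deg g}

theorem finite_minExt {x y v : V} (f : x ⟶ v) (g : y ⟶ v) : Finite (Λ.MinExt f g) := by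
  have := Λ.finite_vertices
  have := fun (v w : V) n => Λ.finite_paths v w n
  let F : Λ.MinExt f g → Σ z : V, {a : z ⟶ x // Λ.deg a = Λ.deg f ⊔ Λ.deg g - Λ.deg f} ×
      {b : z ⟶ y // Λ.deg b = Λ.deg f ⊔ Λ.deg g - Λ.deg g} := fun p =>
    ⟨p.1.1, ⟨p.1.2.1, eq_tsub_of_add_eq
        ((add_comm _ _).trans ((Λ.deg_comp _ _).symm.trans p.2.2))⟩,
      ⟨p.1.2.2, eq_tsub_of_add_eq ((add_comm _ _).trans
        ((Λ.deg_comp _ _).symm.trans ((congrArg (fun h => Λ.deg h) p.2.1).symm.trans p.2.2)))⟩⟩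
  refine Finite.of_injective F ?_
  rintro ⟨⟨z, a, b⟩, h⟩ ⟨⟨z', a', b'⟩, h'⟩ e
  cases e
  rfl

/-- Toeplitz–Cuntz–Krieger `Λ`-families in a C⋆-algebra. -/
structure IsTCKFamily {B : Type*} [NonUnitalCStarAlgebra B]
    (T : ∀ ⦃w v : V⦄, (w ⟶ v) → B) : Prop where
  partialIsometry : ∀ ⦃w v : V⦄ (f : w ⟶ v), T f * star (T f) * T f = T f
  projection : ∀ v : V, IsStarProjection (T (𝟙 v))
  orthogonal : ∀ v w : V, v ≠ w → T (𝟙 v) * T (𝟙 w) = 0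
  mul : ∀ ⦃x w v : V⦄ (f : w ⟶ v) (g : x ⟶ w), T f * T g = T (g ≫ f)
  star_mul : ∀ ⦃x y v : V⦄ (f : x ⟶ v) (g : y ⟶ v),
    star (T f) * T g = ∑ᶠ p : Λ.MinExt f g, T p.1.2.1 * star (T p.1.2.2)
  star_mul_of_ne : ∀ ⦃x y v w : V⦄ (f : x ⟶ v) (g : y ⟶ w), v ≠ w → star (T f) * T g = 0

variable {Λ} in
theorem IsTCKFamily.norm_le_one {B : Type*} [NonUnitalCStarAlgebra B]
    {T : ∀ ⦃w v : V⦄, (w ⟶ v) → B} (h : Λ.IsTCKFamily T) {w v : V} (f : w ⟶ v) :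
    ‖T f‖ ≤ 1 := by
  have h1 : ‖star (T f) * T f‖ = ‖T f‖ * ‖T f‖ := CStarRing.norm_star_mul_self
  have h2 : ‖star (star (T f) * T f) * (star (T f) * T f)‖ =
      ‖star (T f) * T f‖ * ‖star (T f) * T f‖ := CStarRing.norm_star_mul_self
  have h3 : star (star (T f) * T f) * (star (T f) * T f) = star (T f) * T f := by
    rw [StarMul.star_mul, star_star, mul_assoc, ← mul_assoc (T f), h.partialIsometry]
  rw [h3, h1] at h2
  by_contra hc
  push Not at hc
  nlinarith [mul_pos (show (0:ℝ) < ‖T f‖ by linarith) (show (0:ℝ) < ‖T f‖ by linarith),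
    mul_lt_mul'' hc hc zero_le_one zero_le_one]

/-! ### The Toeplitz algebra -/

/-- A Toeplitz–Cuntz–Krieger `Λ`-family in some C⋆-algebra. (As `Λ` is countable, the C⋆-algebra
generated by such a family is separable, so that up to isomorphism all of them occur in `Type`.) -/
structure TCKRep where
  B : Type
  [inst : NonUnitalCStarAlgebra B]
  T : ∀ ⦃w v : V⦄, (w ⟶ v) → B
  isTCK : Λ.IsTCKFamily T

attribute [instance] TCKRep.inst

/-- The direct sum of all Toeplitz–Cuntz–Krieger families. -/
def bigT ⦃w v : V⦄ (f : w ⟶ v) : lp (fun R : Λ.TCKRep => R.B) ∞ :=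
  ⟨fun R => R.T f, memℓp_infty ⟨1, by
    rintro _ ⟨R, rfl⟩
    exact R.isTCK.norm_le_one f⟩⟩

/-- The Toeplitz algebra `𝒯C*(Λ)`: the C⋆-algebra generated by the direct sum of all
Toeplitz–Cuntz–Krieger `Λ`-families. -/
def toeplitzSubalgebra : NonUnitalStarSubalgebra ℂ (lp (fun R : Λ.TCKRep => R.B) ∞) :=
  (NonUnitalStarAlgebra.adjoin ℂ
    {x | ∃ (w v : V) (f : w ⟶ v), x = Λ.bigT f}).topologicalClosure

/-- The Toeplitz algebra `𝒯C*(Λ)`. -/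
def Toeplitz : Type _ := Λ.toeplitzSubalgebra

instance isClosed_toeplitzSubalgebra :
    IsClosed (Λ.toeplitzSubalgebra : Set (lp (fun R : Λ.TCKRep => R.B) ∞)) :=
  NonUnitalStarSubalgebra.isClosed_topologicalClosure _

instance : NonUnitalCStarAlgebra Λ.Toeplitz :=
  inferInstanceAs (NonUnitalCStarAlgebra Λ.toeplitzSubalgebra)

/-- The generators `t_f` of the Toeplitz algebra. -/
def t ⦃w v : V⦄ (f : w ⟶ v) : Λ.Toeplitz :=
  ⟨Λ.bigT f, NonUnitalStarSubalgebra.le_topologicalClosure _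
    (NonUnitalStarAlgebra.subset_adjoin ℂ _ ⟨w, v, f, rfl⟩)⟩

/-- The vertex projections `q_v`. -/
def q (v : V) : Λ.Toeplitz := Λ.t (𝟙 v)

/-- The representation of the Toeplitz algebra given by a family. -/
def eval (R : Λ.TCKRep) : Λ.Toeplitz →⋆ₙₐ[ℂ] R.B where
  toFun x := x.1 R
  map_smul' _ _ := rfl
  map_zero' := rfl
  map_add' _ _ := rfl
  map_mul' _ _ := rfl
  map_star' _ := rfl

@[simp] theorem eval_t (R : Λ.TCKRep) {w v : V} (f : w ⟶ v) : Λ.eval R (Λ.t f) = R.T f := rfl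

variable {Λ}

theorem toeplitz_ext {x y : Λ.Toeplitz} (h : ∀ R, Λ.eval R x = Λ.eval R y) : x = y :=
  Subtype.ext (lp.ext (funext h))

/-- The generators `t_f` generate the Toeplitz algebra. -/
theorem toeplitz_induction {p : Λ.Toeplitz → Prop} (closed : IsClosed {x | p x})
    (t : ∀ ⦃w v : V⦄ (f : w ⟶ v), p (Λ.t f)) (zero : p 0)
    (add : ∀ x y, p x → p y → p (x + y)) (mul : ∀ x y, p x → p y → p (x * y))
    (smul : ∀ (c : ℂ) x, p x → p (c • x)) (star : ∀ x, p x → p (star x)) (x : Λ.Toeplitz) :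
    p x := by
  have key : ∀ (x) (hx : x ∈ NonUnitalStarAlgebra.adjoin ℂ
      {x | ∃ (w v : V) (f : w ⟶ v), x = Λ.bigT f}),
      p ⟨x, NonUnitalStarSubalgebra.le_topologicalClosure _ hx⟩ := by
    intro x hx
    induction hx using NonUnitalStarAlgebra.adjoin_induction with
    | mem x hx =>
      obtain ⟨w, v, f, rfl⟩ := hx
      exact t f
    | add x y hx hy h1 h2 => exact add _ _ h1 h2
    | zero => exact zero
    | mul x y hx hy h1 h2 => exact mul _ _ h1 h2
    | smul c x hx h1 => exact smul c _ h1
    | star x hx h1 => exact star _ h1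
  have hdense : Dense {y : Λ.toeplitzSubalgebra |
      (y : lp (fun R : Λ.TCKRep => R.B) ∞) ∈
      NonUnitalStarAlgebra.adjoin ℂ {x | ∃ (w v : V) (f : w ⟶ v), x = Λ.bigT f}} := by
    intro y
    rw [closure_subtype]
    refine closure_mono ?_ y.2
    intro z hz
    exact ⟨⟨z, NonUnitalStarSubalgebra.le_topologicalClosure _ hz⟩, hz, rfl⟩
  exact closure_minimal (fun (y : Λ.toeplitzSubalgebra) hy => key y.1 hy) closed (hdense x)

variable (Λ) in
/-- The generators `t_f` form a Toeplitz–Cuntz–Krieger family. -/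
theorem isTCKFamily_t : Λ.IsTCKFamily Λ.t where
  partialIsometry _ _ f := toeplitz_ext fun R => by
    simpa only [map_mul, map_star, eval_t] using R.isTCK.partialIsometry f
  projection v := ⟨toeplitz_ext fun R => by
      simpa only [map_mul, eval_t] using (R.isTCK.projection v).1.eq,
    toeplitz_ext fun R => by
      simpa only [map_star, eval_t] using (R.isTCK.projection v).2.star_eq⟩
  orthogonal v w h := toeplitz_ext fun R => by
    simpa only [map_mul, map_zero, eval_t] using R.isTCK.orthogonal v w h
  mul _ _ _ f g := toeplitz_ext fun R => by
    simpa only [map_mul, eval_t] using R.isTCK.mul f g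
  star_mul _ _ _ f g := toeplitz_ext fun R => by
    have := Λ.finite_minExt f g
    rw [map_finsum (Λ.eval R) (Set.toFinite _)]
    simpa only [map_mul, map_star, eval_t] using R.isTCK.star_mul f g
  star_mul_of_ne _ _ _ _ f g h := toeplitz_ext fun R => by
    simpa only [map_mul, map_star, map_zero, eval_t] using R.isTCK.star_mul_of_ne f g h

theorem toeplitz_hom_ext {B : Type*} [NonUnitalCStarAlgebra B] {φ ψ : Λ.Toeplitz →⋆ₙₐ[ℂ] B}
    (h : ∀ ⦃w v : V⦄ (f : w ⟶ v), φ (Λ.t f) = ψ (Λ.t f)) : φ = ψ := by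
  have hφ : Continuous φ := map_continuous φ
  have hψ : Continuous ψ := map_continuous ψ
  ext x
  refine toeplitz_induction (p := fun x => φ x = ψ x) (isClosed_eq hφ hψ) h ?_ ?_ ?_ ?_ ?_ x
  · simp only [map_zero]
  · intro x y hx hy; simp only [map_add, hx, hy]
  · intro x y hx hy; simp only [map_mul, hx, hy]
  · intro c x hx; simp only [map_smul, hx]
  · intro x hx; simp only [map_star, hx]

variable (Λ) in
/-- The universal property of the Toeplitz algebra. -/
theorem existsUnique_hom {B : Type} [NonUnitalCStarAlgebra B] (S : ∀ ⦃w v : V⦄, (w ⟶ v) → B)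
    (hS : Λ.IsTCKFamily S) :
    ∃! φ : Λ.Toeplitz →⋆ₙₐ[ℂ] B, ∀ ⦃w v : V⦄ (f : w ⟶ v), φ (Λ.t f) = S f :=
  ⟨Λ.eval ⟨B, S, hS⟩, fun _ _ _ => rfl,
    fun _ hψ => toeplitz_hom_ext fun _ _ f => hψ f⟩

/-- Homomorphisms preserve Toeplitz–Cuntz–Krieger families. -/
theorem IsTCKFamily.map {A B : Type*} [NonUnitalCStarAlgebra A] [NonUnitalCStarAlgebra B]
    {T : ∀ ⦃w v : V⦄, (w ⟶ v) → A} (h : Λ.IsTCKFamily T) (π : A →⋆ₙₐ[ℂ] B) :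
    Λ.IsTCKFamily (fun _ _ f => π (T f)) where
  partialIsometry _ _ f := by
    simpa only [map_mul, map_star] using congrArg π (h.partialIsometry f)
  projection v := (h.projection v).map π
  orthogonal v w hvw := by
    simpa only [map_mul, map_zero] using congrArg π (h.orthogonal v w hvw)
  mul _ _ _ f g := by simpa only [map_mul] using congrArg π (h.mul f g)
  star_mul _ _ _ f g := by
    have := Λ.finite_minExt f g
    have := congrArg π (h.star_mul f g)
    rw [map_finsum π (Set.toFinite _)] at this
    simpa only [map_mul, map_star] using this
  star_mul_of_ne _ _ _ _ f g hvw := by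
    simpa only [map_mul, map_star, map_zero] using congrArg π (h.star_mul_of_ne f g hvw)

section lift

variable (Λ)
variable {W : Type*} [Category W] {Γ : FinKGraph k W}

/-- The family `S` in `𝒯C*(Γ)`, followed by the representation `R` of `𝒯C*(Γ)`. -/
def pullRep (S : ∀ ⦃w v : V⦄, (w ⟶ v) → Γ.Toeplitz) (hS : Λ.IsTCKFamily S) (R : Γ.TCKRep) :
    Λ.TCKRep := ⟨R.B, fun _ _ f => Γ.eval R (S f), hS.map (Γ.eval R)⟩

/-- The homomorphism of `𝒯C*(Λ)` into the ambient algebra of `𝒯C*(Γ)` given by a family. -/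
def liftAux (S : ∀ ⦃w v : V⦄, (w ⟶ v) → Γ.Toeplitz) (hS : Λ.IsTCKFamily S) :
    Λ.Toeplitz →⋆ₙₐ[ℂ] lp (fun R : Γ.TCKRep => R.B) ∞ where
  toFun x := ⟨fun R => Λ.eval (Λ.pullRep S hS R) x, memℓp_infty ⟨‖x‖, by
    rintro _ ⟨R, rfl⟩
    exact NonUnitalStarAlgHom.norm_apply_le (Λ.eval (Λ.pullRep S hS R)) x⟩⟩
  map_smul' c x := lp.ext (funext fun R => map_smul (Λ.eval (Λ.pullRep S hS R)) c x)
  map_zero' := lp.ext (funext fun R => map_zero (Λ.eval (Λ.pullRep S hS R)))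
  map_add' x y := lp.ext (funext fun R => map_add (Λ.eval (Λ.pullRep S hS R)) x y)
  map_mul' x y := lp.ext (funext fun R => map_mul (Λ.eval (Λ.pullRep S hS R)) x y)
  map_star' x := lp.ext (funext fun R => map_star (Λ.eval (Λ.pullRep S hS R)) x)

theorem liftAux_t (S : ∀ ⦃w v : V⦄, (w ⟶ v) → Γ.Toeplitz) (hS : Λ.IsTCKFamily S)
    {w v : V} (f : w ⟶ v) : Λ.liftAux S hS (Λ.t f) = (S f).1 :=
  lp.ext (funext fun _ => rfl)

theorem liftAux_mem (S : ∀ ⦃w v : V⦄, (w ⟶ v) → Γ.Toeplitz) (hS : Λ.IsTCKFamily S)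
    (x : Λ.Toeplitz) : Λ.liftAux S hS x ∈ Γ.toeplitzSubalgebra := by
  have hcont : Continuous (Λ.liftAux S hS) := map_continuous _
  refine toeplitz_induction (p := fun x => Λ.liftAux S hS x ∈ Γ.toeplitzSubalgebra)
    ((Γ.isClosed_toeplitzSubalgebra).preimage hcont) ?_ ?_ ?_ ?_ ?_ ?_ x
  · intro w v f
    rw [liftAux_t]
    exact (S f).2
  · rw [map_zero]; exact zero_mem _
  · intro x y hx hy; rw [map_add]; exact add_mem hx hy
  · intro x y hx hy; rw [map_mul]; exact mul_mem hx hy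
  · intro c x hx; rw [map_smul]; exact SMulMemClass.smul_mem c hx
  · intro x hx; rw [map_star]; exact star_mem hx

/-- The homomorphism `𝒯C*(Λ) → 𝒯C*(Γ)` that carries `t_f` to `S_f`. -/
def lift (S : ∀ ⦃w v : V⦄, (w ⟶ v) → Γ.Toeplitz) (hS : Λ.IsTCKFamily S) :
    Λ.Toeplitz →⋆ₙₐ[ℂ] Γ.Toeplitz where
  toFun x := ⟨Λ.liftAux S hS x, Λ.liftAux_mem S hS x⟩
  map_smul' c x := Subtype.ext (map_smul (Λ.liftAux S hS) c x)
  map_zero' := Subtype.ext (map_zero (Λ.liftAux S hS))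
  map_add' x y := Subtype.ext (map_add (Λ.liftAux S hS) x y)
  map_mul' x y := Subtype.ext (map_mul (Λ.liftAux S hS) x y)
  map_star' x := Subtype.ext (map_star (Λ.liftAux S hS) x)

@[simp] theorem lift_t (S : ∀ ⦃w v : V⦄, (w ⟶ v) → Γ.Toeplitz) (hS : Λ.IsTCKFamily S)
    {w v : V} (f : w ⟶ v) : Λ.lift S hS (Λ.t f) = S f :=
  Subtype.ext (Λ.liftAux_t S hS f)

end lift

variable (Λ)

/-! ### The gauge action and the dynamics -/

/-- `z^n = ∏ z_i^{n_i}` -/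
def torusPow (z : Fin k → Circle) (n : Fin k → ℕ) : ℂ := ∏ i, (z i : ℂ) ^ n i

theorem torusPow_add (z : Fin k → Circle) (m n : Fin k → ℕ) :
    torusPow z (m + n) = torusPow z m * torusPow z n := by
  simp [torusPow, pow_add, Finset.prod_mul_distrib]

theorem star_torusPow_mul (z : Fin k → Circle) (n : Fin k → ℕ) :
    star (torusPow z n) * torusPow z n = 1 := by
  simp only [torusPow, star_prod, star_pow, ← Finset.prod_mul_distrib, ← mul_pow]
  refine Finset.prod_eq_one fun i _ => ?_
  have : star (z i : ℂ) * z i = 1 := by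
    have := Complex.normSq_eq_conj_mul_self (z := (z i : ℂ))
    simpa using this.symm
  rw [this, one_pow]

/-- The family `z^{d(f)} t_f`. -/
theorem isTCKFamily_gauge (z : Fin k → Circle) :
    Λ.IsTCKFamily (fun _ _ f => torusPow z (Λ.deg f) • Λ.t f) := by
  have h := Λ.isTCKFamily_t
  have hs := star_torusPow_mul z
  have hid : ∀ v : V, torusPow z (Λ.deg (𝟙 v)) = 1 := fun v => by
    rw [Λ.deg_id]; simp [torusPow]
  refine ⟨?_, ?_, ?_, ?_, ?_, ?_⟩
  · intro w v f
    have : torusPow z (Λ.deg f) * star (torusPow z (Λ.deg f)) * torusPow z (Λ.deg f) =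
        torusPow z (Λ.deg f) := by rw [mul_assoc, hs, mul_one]
    simp only [star_smul, smul_mul_assoc, mul_smul_comm, smul_smul]
    rw [h.partialIsometry]
    congr 1
    linear_combination this
  · intro v
    simpa only [hid, one_smul] using h.projection v
  · intro v w hvw
    simpa only [hid, one_smul] using h.orthogonal v w hvw
  · intro x w v f g
    simp only [smul_mul_assoc, mul_smul_comm, smul_smul]
    rw [h.mul, Λ.deg_comp, torusPow_add, mul_comm]
  · intro x y v f g
    have := Λ.finite_minExt f g
    simp only [star_smul, smul_mul_assoc, mul_smul_comm, smul_smul]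
    rw [h.star_mul, smul_finsum' _ (Set.toFinite _)]
    refine finsum_congr fun p => ?_
    congr 1
    have e : Λ.deg f + Λ.deg p.1.2.1 = Λ.deg g + Λ.deg p.1.2.2 := by
      rw [← Λ.deg_comp, ← Λ.deg_comp, p.2.1]
    have e' := congrArg (torusPow z) e
    rw [torusPow_add, torusPow_add] at e'
    have h1 := hs (Λ.deg f)
    have h2 := hs (Λ.deg p.1.2.2)
    linear_combination (-star (torusPow z (Λ.deg f)) * star (torusPow z (Λ.deg p.1.2.2))) * e' +
      (star (torusPow z (Λ.deg p.1.2.2)) * torusPow z (Λ.deg p.1.2.1)) * h1 -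
      (star (torusPow z (Λ.deg f)) * torusPow z (Λ.deg g)) * h2
  · intro x y v w f g hvw
    simp only [star_smul, smul_mul_assoc, mul_smul_comm, h.star_mul_of_ne f g hvw, smul_zero]

/-- The endomorphism `γ_z` with `γ_z(t_f) = z^{d(f)} t_f`. -/
def gaugeHom (z : Fin k → Circle) : Λ.Toeplitz →⋆ₙₐ[ℂ] Λ.Toeplitz :=
  Λ.lift _ (Λ.isTCKFamily_gauge z)

@[simp] theorem gaugeHom_t (z : Fin k → Circle) {w v : V} (f : w ⟶ v) :
    Λ.gaugeHom z (Λ.t f) = torusPow z (Λ.deg f) • Λ.t f := Λ.lift_t _ _ f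

theorem gaugeHom_comp_inv (z z' : Fin k → Circle) (h : ∀ i, z i * z' i = 1) :
    (Λ.gaugeHom z).comp (Λ.gaugeHom z') = NonUnitalStarAlgHom.id ℂ _ := by
  refine toeplitz_hom_ext fun w v f => ?_
  have : torusPow z' (Λ.deg f) * torusPow z (Λ.deg f) = 1 := by
    simp only [torusPow, ← Finset.prod_mul_distrib, ← mul_pow]
    refine Finset.prod_eq_one fun i _ => ?_
    rw [← Circle.coe_mul, mul_comm, h, Circle.coe_one, one_pow]
  simp [smul_smul, this]

/-- The gauge action `γ_z`, `z ∈ 𝕋ᵏ`, on `𝒯C*(Λ)`. -/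
def gauge (z : Fin k → Circle) : Λ.Toeplitz ≃⋆ₐ[ℂ] Λ.Toeplitz :=
  StarAlgEquiv.ofNonUnitalStarAlgHom (Λ.gaugeHom z) (Λ.gaugeHom z⁻¹)
    (Λ.gaugeHom_comp_inv _ _ fun i => inv_mul_cancel (z i))
    (Λ.gaugeHom_comp_inv _ _ fun i => mul_inv_cancel (z i))

/-- The dynamics `α^r_t = γ_{(e^{itr_1}, …, e^{itr_k})}`. -/
def dynamics (r : Fin k → ℝ) (s : ℝ) : Λ.Toeplitz ≃⋆ₐ[ℂ] Λ.Toeplitz :=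
  Λ.gauge fun i => Circle.exp (s * r i)

/-! ### The quotient map -/

open Classical in
/-- The family of `Λ` in `𝒯C*(Λ \ H)` that is `t_f` if `s(f) ∉ H` and `0` otherwise. -/
def quotFamily (H : Set V) (hH : Λ.IsHereditary H) ⦃w v : V⦄ (f : w ⟶ v) :
    (Λ.remove H hH).Toeplitz :=
  if h : w ∉ H then
    (Λ.remove H hH).t (ObjectProperty.homMk f :
      (⟨w, h⟩ : Removed H) ⟶ ⟨v, fun hv => h (hH hv ⟨f⟩)⟩)
  else 0

theorem quotFamily_of_mem (H : Set V) (hH : Λ.IsHereditary H) {w v : V} (f : w ⟶ v)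
    (h : w ∈ H) : Λ.quotFamily H hH f = 0 := dif_neg (not_not.2 h)

theorem quotFamily_coe (H : Set V) (hH : Λ.IsHereditary H) {w v : Removed H} (f : w ⟶ v) :
    Λ.quotFamily H hH f.hom = (Λ.remove H hH).t f := dif_pos w.2

theorem isTCKFamily_quot (H : Set V) (hH : Λ.IsHereditary H) :
    Λ.IsTCKFamily (Λ.quotFamily H hH) := by
  have h := (Λ.remove H hH).isTCKFamily_t
  have hz := fun {w v : V} (f : w ⟶ v) => Λ.quotFamily_of_mem H hH f
  have hc := fun {w v : Removed H} (f : w ⟶ v) => Λ.quotFamily_coe H hH f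
  let mk : ∀ {w v : V} (_ : w ⟶ v) (hw : w ∉ H) (hv : v ∉ H),
      (⟨w, hw⟩ : Removed H) ⟶ ⟨v, hv⟩ := fun f _ _ => ObjectProperty.homMk f
  refine ⟨?_, ?_, ?_, ?_, ?_, ?_⟩
  · intro w v f
    by_cases hw : w ∈ H
    · simp [hz f hw]
    · have hv : v ∉ H := fun hv => hw (hH hv ⟨f⟩)
      exact hc (mk f hw hv) ▸ h.partialIsometry (mk f hw hv)
  · intro v
    by_cases hv : v ∈ H
    · rw [hz _ hv]; exact IsStarProjection.zero _
    · have := h.projection ⟨v, hv⟩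
      rwa [← hc] at this
  · intro v w hvw
    by_cases hv : v ∈ H
    · simp [hz _ hv]
    by_cases hw : w ∈ H
    · simp [hz _ hw]
    have := h.orthogonal ⟨v, hv⟩ ⟨w, hw⟩ (fun e => hvw (congrArg ObjectProperty.FullSubcategory.obj e))
    rwa [← hc, ← hc] at this
  · intro x w v f g
    by_cases hx : x ∈ H
    · rw [hz g hx, hz (g ≫ f) hx, mul_zero]
    have hw : w ∉ H := fun hw => hx (hH hw ⟨g⟩)
    have hv : v ∉ H := fun hv => hw (hH hv ⟨f⟩)
    have := h.mul (mk f hw hv) (mk g hx hw)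
    rwa [← hc, ← hc, ← hc] at this
  · intro x y v f g
    by_cases hx : x ∈ H
    · rw [hz f hx, star_zero, zero_mul]
      refine (finsum_eq_zero_of_forall_eq_zero fun p => ?_).symm
      rw [hz p.1.2.1 (hH hx ⟨p.1.2.1⟩), zero_mul]
    by_cases hy : y ∈ H
    · rw [hz g hy, mul_zero]
      refine (finsum_eq_zero_of_forall_eq_zero fun p => ?_).symm
      rw [hz p.1.2.2 (hH hy ⟨p.1.2.2⟩), star_zero, mul_zero]
    have hv : v ∉ H := fun hv => hx (hH hv ⟨f⟩)
    have := h.star_mul (mk f hx hv) (mk g hy hv)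
    rw [← hc, ← hc] at this
    refine this.trans ?_
    let F : (Λ.remove H hH).MinExt (mk f hx hv) (mk g hy hv) → Λ.MinExt f g := fun p =>
      ⟨⟨p.1.1.obj, p.1.2.1.hom, p.1.2.2.hom⟩,
        congrArg InducedCategory.Hom.hom p.2.1, p.2.2⟩
    have hF : Function.Injective F := by
      rintro ⟨⟨⟨z, _⟩, ⟨a⟩, ⟨b⟩⟩, h⟩ ⟨⟨⟨z', _⟩, ⟨a'⟩, ⟨b'⟩⟩, h'⟩ e
      cases e
      rfl
    have hsupp : Function.support (fun p : Λ.MinExt f g =>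
        Λ.quotFamily H hH p.1.2.1 * star (Λ.quotFamily H hH p.1.2.2)) ⊆ Set.range F := by
      rintro ⟨⟨z, a, b⟩, hp⟩ hne
      have hzH : z ∉ H := fun hzH => hne (by simp [hz a hzH])
      exact ⟨⟨⟨⟨z, hzH⟩, ⟨a⟩, ⟨b⟩⟩, ObjectProperty.hom_ext _ hp.1, hp.2⟩, rfl⟩
    rw [← finsum_mem_univ (fun p : Λ.MinExt f g =>
        Λ.quotFamily H hH p.1.2.1 * star (Λ.quotFamily H hH p.1.2.2)),
      finsum_mem_inter_support_eq _ Set.univ (Set.range F)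
        (by rw [Set.univ_inter, Set.inter_eq_right.2 hsupp]),
      finsum_mem_range hF]
    refine finsum_congr fun p => ?_
    rw [← hc, ← hc]
  · intro x y v w f g hvw
    by_cases hx : x ∈ H
    · rw [hz f hx, star_zero, zero_mul]
    by_cases hy : y ∈ H
    · rw [hz g hy, mul_zero]
    have hv : v ∉ H := fun hv => hx (hH hv ⟨f⟩)
    have hw : w ∉ H := fun hw => hy (hH hw ⟨g⟩)
    have := h.star_mul_of_ne (mk f hx hv) (mk g hy hw)
      (fun e => hvw (congrArg ObjectProperty.FullSubcategory.obj e))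
    rwa [← hc, ← hc] at this

/-- The canonical map `𝒯C*(Λ) → 𝒯C*(Λ \ H)`, for `H` hereditary: it carries `t_f` to `t_f` if
`s(f) ∉ H`, and to `0` otherwise. -/
def quotientMap (H : Set V) (hH : Λ.IsHereditary H) :
    Λ.Toeplitz →⋆ₙₐ[ℂ] (Λ.remove H hH).Toeplitz :=
  Λ.lift (Λ.quotFamily H hH) (Λ.isTCKFamily_quot H hH)

end FinKGraph

/-! ### KMS states -/

section KMS

variable {A : Type*} [NonUnitalCStarAlgebra A]

/-- `F` is an analytic extension to `ℂ` of `s ↦ α_s(a)`. It is unique, and `α_z(a)` denotes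
`F z`. -/
def IsAnalyticExtension (α : ℝ → A ≃⋆ₐ[ℂ] A) (a : A) (F : ℂ → A) : Prop :=
  Differentiable ℂ F ∧ ∀ s : ℝ, F s = α s a

/-- A state of a C⋆-algebra: a positive linear functional of norm one. -/
structure IsState (φ : A →L[ℂ] ℂ) : Prop where
  nonneg : ∀ a, 0 ≤ φ (star a * a)
  norm_eq_one : ‖φ‖ = 1

/-- A state `φ` with `φ(ab) = φ(b α_{iβ}(a))` for all analytic elements `a`, `b`. -/
structure IsKMSState (α : ℝ → A ≃⋆ₐ[ℂ] A) (β : ℝ) (φ : A →L[ℂ] ℂ) : Prop where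
  isState : IsState φ
  kms : ∀ (a b : A) (F : ℂ → A), IsAnalyticExtension α a F →
    (∃ F', IsAnalyticExtension α b F') → φ (a * b) = φ (b * F (Complex.I * β))

end KMS

end

/-! ### Spectral radii of nonnegative matrices -/

namespace Matrix

section Rho

variable {ι κ : Type*}

/-! Put `m_v = φ(q_v)`. The range projections of the edges of degree `e_i` into `v` are mutually
orthogonal and lie under `q_v`, and the KMS condition gives the range projection of an edge with
source `w` the weight `e^{-β r_i} m_w`. Positivity of `φ` therefore yields `A_i m ≤ e^{β r_i} m`
(`sum_vertexMatrix_mul_le`). The same argument for one path shows that zeros of `m` propagate from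
the range of a path to its source (`apply_q_eq_zero_of_hom`), so on a strongly connected component
`m` is either zero or strictly positive. If it were positive on a critical component `C` with
witness `j`, the subinvariance bound `Matrix.rho_le_of_mulVec_le` would give `e^{r_j} = ρ(A_{C,j}) ≤
e^{β r_j}`, which is false for `β < 1`. Hence `m` vanishes on `M` and on its hereditary closure.

It remains to place `H ∪ G` inside that closure. A component critical for `Λ \ H` is critical for
`Λ`, because passing to the subgraph cannot increase `ρ(A_j)` and the normalisation caps it
(`IsCritical.of_remove`). Some minimal critical component leads to it, so it lies in the closure of
`M`. It avoids `H`, so it lies in `M` (`setG_subset_minCritVertices`). Minimality then also makes `H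
∪ G` hereditary.

For the factorisation (`exists_isKMSState_quotient`), Cauchy–Schwarz and the KMS condition give `φ(y
q_v x) = 0` for all `x`, `y` and all `v ∈ H ∪ G`, so the GNS representation of `φ` kills these
`q_v`. It then restricts to a Toeplitz–Cuntz–Krieger family of the smaller graph. The vector state
of the representation so obtained is `ψ`, and its KMS condition need only be checked on the elements
`t_f t_g⋆` (`isKMSState_of_forall_tt`). -/

/-- An entry of a power is a sum over walks, and the walks that stay inside the index subset are
among all walks; nonnegativity makes the omitted ones harmless. -/
theorem pow_submatrix_le [Fintype ι] [Fintype κ] [DecidableEq ι] [DecidableEq κ]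
    {M : Matrix κ κ ℝ} (hM : ∀ i j, 0 ≤ M i j) {f : ι → κ} (hf : Function.Injective f) (n : ℕ) :
    (∀ i j, 0 ≤ (M ^ n) i j) ∧ ∀ i j, 0 ≤ ((M.submatrix f f) ^ n) i j ∧
      ((M.submatrix f f) ^ n) i j ≤ (M ^ n) (f i) (f j) := by
  induction n with
  | zero =>
    simp only [pow_zero, one_apply, hf.eq_iff, le_refl, and_true]
    exact ⟨fun i j => by split_ifs <;> norm_num, fun i j => by split_ifs <;> norm_num⟩
  | succ n ih =>
    obtain ⟨h1, h2⟩ := ih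
    simp only [pow_succ, mul_apply]
    refine ⟨fun i j => Finset.sum_nonneg fun l _ => mul_nonneg (h1 _ _) (hM _ _),
      fun i j => ⟨Finset.sum_nonneg fun l _ => mul_nonneg (h2 _ _).1 (hM _ _), ?_⟩⟩
    calc ∑ l, (M.submatrix f f ^ n) i l * M.submatrix f f l j
        ≤ ∑ l, (M ^ n) (f i) (f l) * M (f l) (f j) :=
          Finset.sum_le_sum fun l _ => mul_le_mul_of_nonneg_right (h2 _ _).2 (hM _ _)
      _ = ∑ l ∈ Finset.univ.map ⟨f, hf⟩, (M ^ n) (f i) l * M l (f j) := by simp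
      _ ≤ ∑ l, (M ^ n) (f i) l * M l (f j) :=
          Finset.sum_le_sum_of_subset_of_nonneg (Finset.subset_univ _)
            fun l _ _ => mul_nonneg (h1 _ _) (hM _ _)

attribute [local instance] Matrix.linftyOpNormedRing Matrix.linftyOpNormedAlgebra

/-- The spectral radius of a principal submatrix of a nonnegative matrix is at most that of the
matrix. -/
theorem rho_submatrix_le [Finite ι] [Finite κ] {M : Matrix κ κ ℝ} (hM : ∀ i j, 0 ≤ M i j)
    {f : ι → κ} (hf : Function.Injective f) : (M.submatrix f f).rho ≤ M.rho := by
  let := Fintype.ofFinite ι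
  let := Fintype.ofFinite κ
  let := Classical.decEq ι
  let := Classical.decEq κ
  have hpow : ∀ n : ℕ, ‖((M.submatrix f f).map Complex.ofReal) ^ n‖₊ ≤
      ‖(M.map Complex.ofReal) ^ n‖₊ := by
    intro n
    obtain ⟨h1, h2⟩ := pow_submatrix_le hM hf n
    have e1 : ((M.submatrix f f).map Complex.ofReal) ^ n =
        ((M.submatrix f f) ^ n).map Complex.ofReal :=
      (map_pow Complex.ofRealHom.mapMatrix (M.submatrix f f) n).symm
    have e2 : (M.map Complex.ofReal) ^ n = (M ^ n).map Complex.ofReal :=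
      (map_pow Complex.ofRealHom.mapMatrix M n).symm
    -- The norm is the maximal absolute row sum, so entrywise domination of nonnegative powers gives
    -- domination of norms. Gelfand's formula then passes this to the spectral radii.
    rw [e1, e2, linfty_opNNNorm_def, linfty_opNNNorm_def]
    refine Finset.sup_le fun i _ => ?_
    refine le_trans ?_ (Finset.le_sup (f := fun i => ∑ j, ‖(M ^ n).map Complex.ofReal i j‖₊)
      (Finset.mem_univ (f i)))
    calc ∑ j, ‖(M.submatrix f f ^ n).map Complex.ofReal i j‖₊
        ≤ ∑ j, ‖(M ^ n).map Complex.ofReal (f i) (f j)‖₊ := by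
          refine Finset.sum_le_sum fun j _ => ?_
          rw [← NNReal.coe_le_coe]
          simp only [map_apply, coe_nnnorm, Complex.norm_real, Real.norm_eq_abs]
          rw [abs_of_nonneg (h2 i j).1, abs_of_nonneg (h1 _ _)]
          exact (h2 i j).2
      _ = ∑ j ∈ Finset.univ.map ⟨f, hf⟩, ‖(M ^ n).map Complex.ofReal (f i) j‖₊ := by simp
      _ ≤ _ := Finset.sum_le_sum_of_subset (Finset.subset_univ _)
  have hle : spectralRadius ℂ ((M.submatrix f f).map Complex.ofReal) ≤
      spectralRadius ℂ (M.map Complex.ofReal) := by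
    refine le_of_tendsto_of_tendsto'
      (spectrum.pow_nnnorm_pow_one_div_tendsto_nhds_spectralRadius _)
      (spectrum.pow_nnnorm_pow_one_div_tendsto_nhds_spectralRadius _) fun n => ?_
    exact ENNReal.rpow_le_rpow (by exact_mod_cast hpow n) (by positivity)
  refine ENNReal.toReal_mono ?_ hle
  -- `toReal` sends `∞` to `0`, so its monotonicity needs a finite upper bound; the norm estimate
  -- with exponent `1` supplies it.
  refine ne_top_of_le_ne_top ?_ (spectrum.spectralRadius_le_pow_nnnorm_pow_one_div ℂ
    (M.map Complex.ofReal) 0)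
  norm_num
  exact ENNReal.mul_ne_top ENNReal.coe_ne_top ENNReal.coe_ne_top

theorem zero_le_rho [Finite ι] (M : Matrix ι ι ℝ) : 0 ≤ M.rho := ENNReal.toReal_nonneg

/-- The subinvariance bound for the spectral radius of a nonnegative matrix. -/
theorem rho_le_of_mulVec_le [Fintype ι] {M : Matrix ι ι ℝ} (hM : ∀ i j, 0 ≤ M i j)
    {m : ι → ℝ} (hm : ∀ i, 0 < m i) {c : ℝ} (hc : 0 ≤ c)
    (h : ∀ i, ∑ j, M i j * m j ≤ c * m i) : M.rho ≤ c := by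
  -- `Matrix.rho` is defined with the instance `Fintype.ofFinite`, so the sums in `h` are moved to
  -- that instance.
  rw [Subsingleton.elim (inferInstanceAs (Fintype ι)) (Fintype.ofFinite ι)] at h
  let := Fintype.ofFinite ι
  let := Classical.decEq ι
  refine ENNReal.toReal_le_of_le_ofReal hc (iSup₂_le fun z hz => ?_)
  rw [spectrum.mem_iff, isUnit_iff_isUnit_det, isUnit_iff_ne_zero, not_not,
    ← exists_mulVec_eq_zero_iff] at hz
  obtain ⟨x, hx0, hx⟩ := hz
  have hx' : ∀ i, z * x i = ∑ j, (M i j : ℂ) * x j := by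
    intro i
    have := congrFun hx i
    rw [sub_mulVec, Pi.sub_apply, Algebra.algebraMap_eq_smul_one, smul_mulVec, one_mulVec,
      Pi.zero_apply, sub_eq_zero] at this
    simpa [mulVec, dotProduct] using this
  obtain ⟨i₁, hi₁⟩ := Function.ne_iff.1 hx0
  -- For an eigenvector `x` of eigenvalue `z`, the eigenvalue equation is read at an index that
  -- maximises `|x_i| / m_i`. There `|x| ≤ t m` holds with equality, which forces `|z| ≤ c`.
  obtain ⟨i₀, -, hi₀⟩ := Finset.exists_max_image Finset.univ (fun i => ‖x i‖ / m i)
    ⟨i₁, Finset.mem_univ _⟩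
  set t := ‖x i₀‖ / m i₀ with ht
  have hle : ∀ i, ‖x i‖ ≤ t * m i := fun i => (div_le_iff₀ (hm i)).1 (hi₀ i (Finset.mem_univ i))
  have htpos : 0 < t := lt_of_lt_of_le (div_pos (norm_pos_iff.2 hi₁) (hm i₁))
    (hi₀ i₁ (Finset.mem_univ _))
  have hxt : ‖x i₀‖ = t * m i₀ := by rw [ht, div_mul_cancel₀ _ (hm i₀).ne']
  have key : ‖z‖ * (t * m i₀) ≤ c * (t * m i₀) := by
    rw [← hxt, ← norm_mul, hx' i₀]
    calc ‖∑ j, (M i₀ j : ℂ) * x j‖ ≤ ∑ j, ‖(M i₀ j : ℂ) * x j‖ := norm_sum_le _ _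
      _ ≤ ∑ j, t * (M i₀ j * m j) := by
          refine Finset.sum_le_sum fun j _ => ?_
          rw [norm_mul, Complex.norm_real, Real.norm_eq_abs, abs_of_nonneg (hM _ _)]
          nlinarith [mul_le_mul_of_nonneg_left (hle j) (hM i₀ j)]
      _ = t * ∑ j, M i₀ j * m j := by rw [Finset.mul_sum]
      _ ≤ t * (c * m i₀) := mul_le_mul_of_nonneg_left (h i₀) htpos.le
      _ = c * ‖x i₀‖ := by rw [hxt]; ring
  have hz : ‖z‖ ≤ c := le_of_mul_le_mul_right key (mul_pos htpos (hm i₀))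
  exact ENNReal.coe_le_coe.2 (norm_toNNReal (a := z) ▸ Real.toNNReal_le_toNNReal hz)

end Rho

end Matrix

namespace FinKGraph

variable {k : ℕ} {V : Type u} [Category.{v} V] (Λ : FinKGraph k V)

/-! ### Paths of equal degree and the unit -/

variable {Λ}

/-- Both `(f, 𝟙)` and `(𝟙, f)` factor `f` in degrees `0 + 0`, so unique factorisation identifies
them. -/
theorem eq_id_of_deg_eq_zero {w v : V} (f : w ⟶ v) (h : Λ.deg f = 0) :
    ∃ e : w = v, f = eqToHom e := by
  obtain ⟨p, -, hp⟩ := Λ.factorisation f 0 0 (by simpa using h)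
  have h1 := hp ⟨w, f, 𝟙 w⟩ ⟨h, Λ.deg_id w, Category.id_comp f⟩
  have h2 := hp ⟨v, 𝟙 v, f⟩ ⟨Λ.deg_id v, h, Category.comp_id f⟩
  have h3 := h1.trans h2.symm
  have e : w = v := congrArg Sigma.fst h3
  subst e
  refine ⟨rfl, ?_⟩
  have h4 := eq_of_heq (Sigma.mk.inj h3).2
  exact congrArg Prod.fst h4

theorem deg_eq_zero_of_comp {x w v : V} {a : x ⟶ w} {f : w ⟶ v}
    (h : Λ.deg (a ≫ f) = Λ.deg f) : Λ.deg a = 0 := by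
  rw [Λ.deg_comp] at h
  exact add_eq_left.1 h

/-- Paths with a common extension of their common degree are equal. -/
theorem sigma_eq_of_minExt {x y v : V} {f : x ⟶ v} {g : y ⟶ v} (h : Λ.deg f = Λ.deg g)
    (p : Λ.MinExt f g) : (⟨x, f⟩ : Σ x, x ⟶ v) = ⟨y, g⟩ := by
  obtain ⟨⟨z, a, b⟩, h1, h2⟩ := p
  dsimp only at h1 h2
  have ha : Λ.deg a = 0 := deg_eq_zero_of_comp (f := f) (by rw [h2, h, sup_idem])
  have hb : Λ.deg b = 0 := deg_eq_zero_of_comp (f := g) (by rw [← h1, h2, h, sup_idem])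
  obtain ⟨rfl, rfl⟩ := eq_id_of_deg_eq_zero a ha
  obtain ⟨rfl, rfl⟩ := eq_id_of_deg_eq_zero b hb
  simp only [eqToHom_refl, Category.id_comp] at h1
  rw [h1]

variable (Λ)

theorem star_t_mul_t_self {w v : V} (f : w ⟶ v) : star (Λ.t f) * Λ.t f = Λ.q w := by
  rw [Λ.isTCKFamily_t.star_mul]
  -- The only minimal common extension of `f` with itself is the pair of identities, as any other
  -- pair would also have degree `0`.
  rw [finsum_eq_single _ (⟨⟨w, 𝟙 w, 𝟙 w⟩, rfl, by simp⟩ : Λ.MinExt f f)]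
  · dsimp only
    rw [(Λ.isTCKFamily_t.projection w).2.star_eq, (Λ.isTCKFamily_t.projection w).1.eq]
    rfl
  · rintro ⟨⟨z, a, b⟩, h1, h2⟩ hne
    refine (hne ?_).elim
    clear hne
    dsimp only at h1 h2
    have ha : Λ.deg a = 0 := deg_eq_zero_of_comp (f := f) (by rw [h2, sup_idem])
    have hb : Λ.deg b = 0 := deg_eq_zero_of_comp (f := f) (by rw [← h1, h2, sup_idem])
    obtain ⟨rfl, rfl⟩ := eq_id_of_deg_eq_zero a ha
    obtain ⟨-, rfl⟩ := eq_id_of_deg_eq_zero b hb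
    rfl

theorem star_t_mul_t_of_ne {x y v : V} {f : x ⟶ v} {g : y ⟶ v} (h : Λ.deg f = Λ.deg g)
    (hne : (⟨x, f⟩ : Σ x, x ⟶ v) ≠ ⟨y, g⟩) : star (Λ.t f) * Λ.t g = 0 := by
  rw [Λ.isTCKFamily_t.star_mul]
  have : IsEmpty (Λ.MinExt f g) := ⟨fun p => hne (sigma_eq_of_minExt h p)⟩
  exact finsum_of_isEmpty _

theorem q_mul_q_self (v : V) : Λ.q v * Λ.q v = Λ.q v := (Λ.isTCKFamily_t.projection v).1.eq

theorem star_q (v : V) : star (Λ.q v) = Λ.q v := (Λ.isTCKFamily_t.projection v).2.star_eq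

theorem q_mul_t {w v : V} (f : w ⟶ v) : Λ.q v * Λ.t f = Λ.t f := by
  rw [q, Λ.isTCKFamily_t.mul, Category.comp_id]

theorem t_mul_q {w v : V} (f : w ⟶ v) : Λ.t f * Λ.q w = Λ.t f := by
  rw [q, Λ.isTCKFamily_t.mul, Category.id_comp]

theorem q_mul_t_of_ne {u w v : V} (f : w ⟶ v) (h : u ≠ v) : Λ.q u * Λ.t f = 0 := by
  have := Λ.isTCKFamily_t.star_mul_of_ne (𝟙 u) f h
  rwa [(Λ.isTCKFamily_t.projection u).2.star_eq] at this

theorem t_mul_q_of_ne {u w v : V} (f : w ⟶ v) (h : u ≠ w) : Λ.t f * Λ.q u = 0 := by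
  rw [← t_mul_q, mul_assoc, q, q, Λ.isTCKFamily_t.orthogonal _ _ h.symm, mul_zero]

/-- The unit of the Toeplitz algebra. -/
noncomputable def unit : Λ.Toeplitz := ∑ᶠ v, Λ.q v

/-- On a generator only the summand at its range, respectively its source, survives. The two sides
are proved together because taking adjoints exchanges them. -/
theorem unit_mul_mul_unit (x : Λ.Toeplitz) : Λ.unit * x = x ∧ x * Λ.unit = x := by
  have := Λ.finite_vertices
  let := Fintype.ofFinite V
  have hl : Continuous fun x : Λ.Toeplitz => Λ.unit * x := by fun_prop
  have hr : Continuous fun x : Λ.Toeplitz => x * Λ.unit := by fun_prop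
  have hu : Λ.unit = ∑ v, Λ.q v := finsum_eq_sum_of_fintype _
  have hs : star Λ.unit = Λ.unit := by rw [hu, star_sum]; simp only [star_q]
  refine toeplitz_induction (p := fun x => Λ.unit * x = x ∧ x * Λ.unit = x)
    ((isClosed_eq hl continuous_id).inter (isClosed_eq hr continuous_id)) ?_ ?_ ?_ ?_ ?_ ?_ x
  · intro w v f
    rw [hu, Finset.sum_mul, Finset.mul_sum, Finset.sum_eq_single v, Finset.sum_eq_single w]
    · exact ⟨Λ.q_mul_t f, Λ.t_mul_q f⟩
    · exact fun u _ h => Λ.t_mul_q_of_ne f h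
    · simp
    · exact fun u _ h => Λ.q_mul_t_of_ne f h
    · simp
  · simp
  · rintro x y ⟨h1, h2⟩ ⟨h3, h4⟩
    exact ⟨by rw [mul_add, h1, h3], by rw [add_mul, h2, h4]⟩
  · rintro x y ⟨h1, h2⟩ ⟨h3, h4⟩
    exact ⟨by rw [← mul_assoc, h1], by rw [mul_assoc, h4]⟩
  · rintro c x ⟨h1, h2⟩
    exact ⟨by rw [mul_smul_comm, h1], by rw [smul_mul_assoc, h2]⟩
  · rintro x ⟨h1, h2⟩
    refine ⟨?_, ?_⟩
    · rw [← hs, ← StarMul.star_mul, h2]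
    · rw [← hs, ← StarMul.star_mul, h1]

theorem unit_mul (x : Λ.Toeplitz) : Λ.unit * x = x := (Λ.unit_mul_mul_unit x).1

theorem mul_unit (x : Λ.Toeplitz) : x * Λ.unit = x := (Λ.unit_mul_mul_unit x).2

theorem star_unit : star Λ.unit = Λ.unit := by
  rw [← Λ.mul_unit (star Λ.unit)]
  nth_rw 2 [← star_star Λ.unit]
  rw [← StarMul.star_mul, Λ.mul_unit, star_star]

/-! ### The spanning set `t_f t_g⋆` -/

/-- The pairs of paths with a common source. -/
def PathPair (_Λ : FinKGraph k V) : Type _ := Σ (x v w : V), (x ⟶ v) × (x ⟶ w)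

/-- The element `t_f t_g⋆`. -/
noncomputable def tt (p : Λ.PathPair) : Λ.Toeplitz := Λ.t p.2.2.2.1 * star (Λ.t p.2.2.2.2)

theorem countable_hom (Λ : FinKGraph k V) (w v : V) : Countable (w ⟶ v) := by
  have := fun n => Λ.finite_paths v w n
  exact Function.Injective.countable
    (f := fun f : w ⟶ v => (⟨Λ.deg f, f, rfl⟩ : Σ n, {f : w ⟶ v // Λ.deg f = n}))
    fun f g h => congrArg (fun p => (p.2 : w ⟶ v)) h

instance countable_pathPair : Countable Λ.PathPair := by
  have := Λ.finite_vertices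
  have := Λ.countable_hom
  unfold PathPair
  infer_instance

/-- The inner factor `t_g⋆ t_{f'}` is a finite sum of terms `t_a t_b⋆` over minimal common
extensions, and the outer factors absorb `a` and `b`. -/
theorem tt_mul_tt_mem (p p' : Λ.PathPair) :
    Λ.tt p * Λ.tt p' ∈ Submodule.span ℂ (Set.range Λ.tt) := by
  obtain ⟨x, v, w, f, g⟩ := p
  obtain ⟨x', v', w', f', g'⟩ := p'
  have e : Λ.tt ⟨x, v, w, f, g⟩ * Λ.tt ⟨x', v', w', f', g'⟩ =
      Λ.t f * (star (Λ.t g) * Λ.t f') * star (Λ.t g') := by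
    simp only [tt, mul_assoc]
  rw [e]
  by_cases h : w = v'
  · subst h
    have := Λ.finite_minExt g f'
    let := Fintype.ofFinite (Λ.MinExt g f')
    rw [Λ.isTCKFamily_t.star_mul, finsum_eq_sum_of_fintype, Finset.mul_sum, Finset.sum_mul]
    refine Submodule.sum_mem _ fun q _ => Submodule.subset_span
      ⟨⟨q.1.1, v, w', q.1.2.1 ≫ f, q.1.2.2 ≫ g'⟩, ?_⟩
    dsimp only [tt]
    rw [← Λ.isTCKFamily_t.mul, ← Λ.isTCKFamily_t.mul, StarMul.star_mul]
    simp only [mul_assoc]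
  · rw [Λ.isTCKFamily_t.star_mul_of_ne g f' h, mul_zero, zero_mul]
    exact zero_mem _

/-- The elements `t_f t_g⋆` span a dense subspace of the Toeplitz algebra. -/
theorem dense_span_tt : Dense (Submodule.span ℂ (Set.range Λ.tt) : Set Λ.Toeplitz) := by
  set W := Submodule.span ℂ (Set.range Λ.tt) with hW
  have hcoe : closure (W : Set Λ.Toeplitz) = W.topologicalClosure :=
    (Submodule.topologicalClosure_coe W).symm
  have hmul : ∀ x ∈ W, ∀ y ∈ W, x * y ∈ W := by
    intro x hx y hy
    induction hx, hy using Submodule.span_induction₂ with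
    | mem_mem x y hx hy =>
      obtain ⟨p, rfl⟩ := hx
      obtain ⟨p', rfl⟩ := hy
      exact Λ.tt_mul_tt_mem p p'
    | zero_left => simp
    | zero_right => simp
    | add_left x y z _ _ _ h1 h2 => rw [add_mul]; exact add_mem h1 h2
    | add_right x y z _ _ _ h1 h2 => rw [mul_add]; exact add_mem h1 h2
    | smul_left c x y _ _ h => rw [smul_mul_assoc]; exact W.smul_mem c h
    | smul_right c x y _ _ h => rw [mul_smul_comm]; exact W.smul_mem c h
  have hstar : ∀ x ∈ W, star x ∈ W := by
    intro x hx
    induction hx using Submodule.span_induction with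
    | mem x hx =>
      obtain ⟨⟨x, v, w, f, g⟩, rfl⟩ := hx
      refine Submodule.subset_span ⟨⟨x, w, v, g, f⟩, ?_⟩
      simp [tt]
    | zero => simp
    | add x y _ _ h1 h2 => rw [star_add]; exact add_mem h1 h2
    | smul c x _ h => rw [star_smul]; exact W.smul_mem _ h
  intro x
  refine toeplitz_induction (p := fun x => x ∈ closure (W : Set Λ.Toeplitz)) isClosed_closure
    ?_ ?_ ?_ ?_ ?_ ?_ x
  · intro w v f
    refine subset_closure (Submodule.subset_span ⟨⟨w, v, w, f, 𝟙 w⟩, ?_⟩)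
    dsimp only [tt]
    rw [(Λ.isTCKFamily_t.projection w).2.star_eq]
    exact Λ.t_mul_q f
  · exact subset_closure (zero_mem W)
  · intro x y hx hy
    rw [hcoe] at *
    exact add_mem hx hy
  · intro x y hx hy
    exact map_mem_closure₂ continuous_mul hx hy fun a ha b hb => hmul a ha b hb
  · intro c x hx
    rw [hcoe] at *
    exact Submodule.smul_mem _ c hx
  · intro x hx
    exact map_mem_closure continuous_star hx hstar

/-- Separability is what allows the GNS space to be modelled by a Hilbert space in `Type`, as
`TCKRep` demands. -/
instance separableSpace_toeplitz : TopologicalSpace.SeparableSpace Λ.Toeplitz := by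
  have h : TopologicalSpace.IsSeparable (Submodule.span ℂ (Set.range Λ.tt) : Set Λ.Toeplitz) :=
    (Set.countable_range _).isSeparable.span
  obtain ⟨c, hc, hsub⟩ := h
  exact ⟨c, hc, dense_closure.1 (Λ.dense_span_tt.mono hsub)⟩

end FinKGraph

namespace FinKGraph

variable {k : ℕ} {V : Type u} [Category.{v} V] (Λ : FinKGraph k V)

/-! ### KMS states on the spanning set -/

/-- The weight `r · (d(f) - d(g))` of `t_f t_g⋆` under the dynamics. -/
def ttWeight (r : Fin k → ℝ) (p : Λ.PathPair) : ℝ :=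
  (∑ i, r i * Λ.deg p.2.2.2.1 i) - ∑ i, r i * Λ.deg p.2.2.2.2 i

theorem dynamics_t (r : Fin k → ℝ) (s : ℝ) {w v : V} (f : w ⟶ v) :
    Λ.dynamics r s (Λ.t f) =
      Complex.exp (Complex.I * s * (∑ i, r i * Λ.deg f i : ℝ)) • Λ.t f := by
  have h : torusPow (fun i => Circle.exp (s * r i)) (Λ.deg f) =
      Complex.exp (Complex.I * s * (∑ i, r i * Λ.deg f i : ℝ)) := by
    simp only [torusPow, Circle.coe_exp, ← Complex.exp_nat_mul]
    rw [← Complex.exp_sum]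
    congr 1
    push_cast
    rw [Finset.mul_sum]
    exact Finset.sum_congr rfl fun i _ => by ring
  rw [← h]
  exact Λ.gaugeHom_t _ f

theorem dynamics_tt (r : Fin k → ℝ) (s : ℝ) (p : Λ.PathPair) :
    Λ.dynamics r s (Λ.tt p) = Complex.exp (Complex.I * s * Λ.ttWeight r p) • Λ.tt p := by
  rw [tt, map_mul, map_star, dynamics_t, dynamics_t, star_smul, smul_mul_smul_comm]
  congr 1
  rw [← starRingEnd_apply, ← Complex.exp_conj, ← Complex.exp_add]
  congr 1
  simp only [map_mul, Complex.conj_I, Complex.conj_ofReal, ttWeight]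
  push_cast
  ring

/-- An eigenvector of the dynamics is analytic. -/
theorem isAnalyticExtension_of_eigenvector {A : Type*} [NonUnitalCStarAlgebra A]
    {α : ℝ → A ≃⋆ₐ[ℂ] A} {a : A} {l : ℝ}
    (h : ∀ s : ℝ, α s a = Complex.exp (Complex.I * s * l) • a) :
    IsAnalyticExtension α a fun z => Complex.exp (Complex.I * z * l) • a :=
  ⟨by fun_prop, fun s => (h s).symm⟩

theorem exp_I_mul_I_mul (β l : ℝ) :
    Complex.exp (Complex.I * (Complex.I * β) * l) = Complex.exp (-(β * l)) := by
  congr 1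
  linear_combination ((β : ℂ) * l) * Complex.I_mul_I

variable {Λ} in
/-- Continuous functionals that agree on all `t_f t_g⋆` are equal. -/
theorem clm_ext {φ ψ : Λ.Toeplitz →L[ℂ] ℂ} (h : ∀ p, φ (Λ.tt p) = ψ (Λ.tt p)) : φ = ψ :=
  ContinuousLinearMap.ext_on Λ.dense_span_tt (by rintro _ ⟨p, rfl⟩; exact h p)

variable {Λ} in
theorem apply_tt_mul_of_forall_tt {ψ : Λ.Toeplitz →L[ℂ] ℂ} {c : Λ.PathPair → ℂ}
    (h : ∀ p p', ψ (Λ.tt p * Λ.tt p') = c p * ψ (Λ.tt p' * Λ.tt p)) (p : Λ.PathPair)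
    (x : Λ.Toeplitz) : ψ (Λ.tt p * x) = c p * ψ (x * Λ.tt p) :=
  DFunLike.congr_fun (clm_ext (φ := ψ.comp (ContinuousLinearMap.mul ℂ _ (Λ.tt p)))
    (ψ := c p • ψ.comp ((ContinuousLinearMap.mul ℂ _).flip (Λ.tt p))) (h p)) x

variable {Λ} in
-- Each `t_f t_g⋆` is an eigenvector of the dynamics, hence analytic with explicit value at `iβ`. By
-- density the second factor may then be any element, analytic or not.
theorem apply_tt_mul_of_isKMSState {r : Fin k → ℝ} {β : ℝ} {φ : Λ.Toeplitz →L[ℂ] ℂ}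
    (hφ : IsKMSState (Λ.dynamics r) β φ) (p : Λ.PathPair) (x : Λ.Toeplitz) :
    φ (Λ.tt p * x) = Complex.exp (-(β * Λ.ttWeight r p)) * φ (x * Λ.tt p) := by
  refine apply_tt_mul_of_forall_tt (c := fun p => Complex.exp (-(β * Λ.ttWeight r p)))
    (fun p p' => ?_) p x
  rw [hφ.kms _ _ _ (isAnalyticExtension_of_eigenvector fun s => Λ.dynamics_tt r s p)
    ⟨_, isAnalyticExtension_of_eigenvector fun s => Λ.dynamics_tt r s p'⟩, exp_I_mul_I_mul,
    mul_smul_comm, map_smul, smul_eq_mul]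

variable {Λ} in
/-- A state that satisfies the KMS condition on the elements `t_f t_g⋆` is a KMS state. -/
theorem isKMSState_of_forall_tt {r : Fin k → ℝ} {β : ℝ} {ψ : Λ.Toeplitz →L[ℂ] ℂ}
    (hψ : IsState ψ)
    (h : ∀ p p', ψ (Λ.tt p * Λ.tt p') =
      Complex.exp (-(β * Λ.ttWeight r p)) * ψ (Λ.tt p' * Λ.tt p)) :
    IsKMSState (Λ.dynamics r) β ψ := by
  have key := apply_tt_mul_of_forall_tt h
  refine ⟨hψ, fun a b F hF _ => ?_⟩
  suffices H : ∀ p, ψ (a * Λ.tt p) = ψ (Λ.tt p * F (Complex.I * β)) from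
    DFunLike.congr_fun (clm_ext (φ := ψ.comp (ContinuousLinearMap.mul ℂ _ a))
      (ψ := ψ.comp ((ContinuousLinearMap.mul ℂ _).flip (F (Complex.I * β)))) H) b
  intro p
  rw [key]
  -- At `β = 0` the condition is traciality and does not imply invariance under the dynamics; here
  -- simply `F(0) = a`.
  by_cases hβ : β = 0
  · have h0 : F (Complex.I * β) = a := by
      have := hF.2 0
      have hid : Λ.dynamics r 0 a = a := by
        have : (Λ.gaugeHom fun i => Circle.exp (0 * r i)) = NonUnitalStarAlgHom.id ℂ _ :=
          toeplitz_hom_ext fun w v f => by simp [torusPow]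
        exact DFunLike.congr_fun this a
      rw [hβ]
      simpa [hid] using this
    rw [h0, hβ]
    simp
  have hinv : ∀ (s : ℝ) (x : Λ.Toeplitz), ψ (Λ.dynamics r s x) = ψ x := by
    intro s x
    have hcont : Continuous (Λ.gaugeHom fun i => Circle.exp (s * r i)) := map_continuous _
    let D : Λ.Toeplitz →L[ℂ] Λ.Toeplitz :=
      ⟨(Λ.gaugeHom fun i => Circle.exp (s * r i)), hcont⟩
    refine DFunLike.congr_fun (clm_ext (φ := ψ.comp D) (ψ := ψ) fun p => ?_) x
    change ψ (Λ.dynamics r s (Λ.tt p)) = _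
    rw [dynamics_tt, map_smul, smul_eq_mul]
    by_cases hl : Λ.ttWeight r p = 0
    · simp [hl]
    -- Commuting `t_f t_g⋆` past the unit multiplies its value by `e^{-βl}`, which is not `1` when
    -- `β` and the weight `l` are nonzero. So `ψ` vanishes on every spanning element that the
    -- dynamics moves.
    have h1 := key p Λ.unit
    rw [mul_unit, unit_mul] at h1
    have h2 : Complex.exp (-(β * Λ.ttWeight r p)) ≠ 1 := by
      rw [← Complex.ofReal_mul, ← Complex.ofReal_neg, ← Complex.ofReal_exp]
      intro h
      have := Complex.ofReal_eq_one.1 h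
      rw [Real.exp_eq_one_iff, neg_eq_zero, mul_eq_zero] at this
      tauto
    have h3 : ψ (Λ.tt p) = 0 := by
      have : (1 - Complex.exp (-(β * Λ.ttWeight r p))) * ψ (Λ.tt p) = 0 := by
        linear_combination h1
      exact (mul_eq_zero.1 this).resolve_left (sub_ne_zero.2 h2.symm)
    rw [h3, mul_zero]
  set l := Λ.ttWeight r p with hl
  have hreal : ∀ s : ℝ, ψ (F s * Λ.tt p) = Complex.exp (-(Complex.I * s * l)) *
      ψ (a * Λ.tt p) := by
    intro s
    rw [← hinv s (a * Λ.tt p), map_mul (Λ.dynamics r s), dynamics_tt, mul_smul_comm,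
      map_smul, hF.2 s, smul_eq_mul,
      ← mul_assoc, ← Complex.exp_add, neg_add_cancel, Complex.exp_zero, one_mul]
  have hd1 : Differentiable ℂ fun z => ψ (F z * Λ.tt p) :=
    (ψ.comp ((ContinuousLinearMap.mul ℂ Λ.Toeplitz).flip (Λ.tt p))).differentiable.comp hF.1
  have hd2 : Differentiable ℂ fun z : ℂ => Complex.exp (-(Complex.I * z * l)) *
      ψ (a * Λ.tt p) := by fun_prop
  have heq : (fun z => ψ (F z * Λ.tt p)) = fun z : ℂ => Complex.exp (-(Complex.I * z * l)) *
      ψ (a * Λ.tt p) := by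
    -- Invariance gives the identity for real times; the identity theorem carries it to `z = iβ`,
    -- where its exponential factor cancels the one from `key`.
    refine AnalyticOnNhd.eq_of_frequently_eq (z₀ := 0)
      (fun z _ => hd1.analyticAt z) (fun z _ => hd2.analyticAt z) ?_
    have ht : Filter.Tendsto (fun s : ℝ => (s : ℂ)) (nhdsWithin 0 {0}ᶜ) (nhdsWithin 0 {0}ᶜ) := by
      refine tendsto_nhdsWithin_iff.2 ⟨?_, ?_⟩
      · exact (Complex.continuous_ofReal.tendsto' 0 0 Complex.ofReal_zero).mono_left
          nhdsWithin_le_nhds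
      · filter_upwards [self_mem_nhdsWithin] with s hs
        simpa using hs
    exact ht.frequently (Filter.Eventually.of_forall hreal).frequently
  rw [congrFun heq (Complex.I * β), ← mul_assoc, ← Complex.exp_add]
  have e : -((β : ℂ) * l) + -(Complex.I * (Complex.I * β) * l) = 0 := by
    linear_combination (-(β : ℂ) * l) * Complex.I_mul_I
  rw [e, Complex.exp_zero, one_mul]

/-! ### The weights of the vertex projections -/

section Weights

variable {Λ}
variable {r : Fin k → ℝ} {β : ℝ} {φ : Λ.Toeplitz →L[ℂ] ℂ}

theorem apply_nonneg_of_isStarProjection {A : Type*} [NonUnitalCStarAlgebra A] {φ : A →L[ℂ] ℂ}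
    (hφ : IsState φ) {p : A} (hp : IsStarProjection p) : 0 ≤ φ p := by
  have := hφ.nonneg p
  rwa [hp.2.star_eq, hp.1.eq] at this

theorem apply_q_nonneg (hφ : IsState φ) (v : V) : 0 ≤ φ (Λ.q v) :=
  apply_nonneg_of_isStarProjection hφ (Λ.isTCKFamily_t.projection v)

theorem ofReal_re_apply_q (hφ : IsState φ) (v : V) : ((φ (Λ.q v)).re : ℂ) = φ (Λ.q v) :=
  (Complex.eq_re_of_ofReal_le (r := 0) (by simpa using apply_q_nonneg hφ v)).symm

/-- The KMS condition turns `t_f t_f⋆` into `t_f⋆ t_f = q_w` at the cost of the exponential factor.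
-/
theorem apply_t_mul_star_t (hφ : IsKMSState (Λ.dynamics r) β φ) {w v : V} (f : w ⟶ v) :
    φ (Λ.t f * star (Λ.t f)) = Real.exp (-(β * ∑ i, r i * Λ.deg f i)) * φ (Λ.q w) := by
  have h := apply_tt_mul_of_isKMSState hφ ⟨w, v, w, f, 𝟙 w⟩ (star (Λ.t f))
  have e : Λ.tt ⟨w, v, w, f, 𝟙 w⟩ = Λ.t f := by
    dsimp only [tt]
    rw [(Λ.isTCKFamily_t.projection w).2.star_eq]
    exact Λ.t_mul_q f
  rw [e, star_t_mul_t_self] at h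
  rw [h]
  simp [ttWeight, Λ.deg_id]

/-- The range projections of the paths of degree `n` into `v` sum to a projection under `q_v`. -/
theorem isStarProjection_q_sub (v : V) (n : Fin k → ℕ)
    [Fintype (Σ w : V, {f : w ⟶ v // Λ.deg f = n})] :
    IsStarProjection (Λ.q v - ∑ p : Σ w : V, {f : w ⟶ v // Λ.deg f = n},
      Λ.t p.2.1 * star (Λ.t p.2.1)) := by
  set S := ∑ p : Σ w : V, {f : w ⟶ v // Λ.deg f = n}, Λ.t p.2.1 * star (Λ.t p.2.1) with hS
  have h1 : Λ.q v * S = S := by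
    rw [hS, Finset.mul_sum]
    refine Finset.sum_congr rfl fun p _ => ?_
    rw [← mul_assoc, q_mul_t]
  have h2 : star S = S := by
    rw [hS, star_sum]
    refine Finset.sum_congr rfl fun p _ => ?_
    rw [StarMul.star_mul, star_star]
  have h3 : S * Λ.q v = S := by
    rw [← h2, ← Λ.star_q v, ← StarMul.star_mul, h1]
  have h4 : S * S = S := by
    nth_rw 1 [hS]
    rw [Finset.sum_mul, hS]
    refine Finset.sum_congr rfl fun p _ => ?_
    rw [Finset.mul_sum, Finset.sum_eq_single p]
    · rw [mul_assoc, ← mul_assoc (star _), star_t_mul_t_self, ← mul_assoc, t_mul_q]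
    · intro p' _ hne
      rw [mul_assoc, ← mul_assoc (star _), star_t_mul_t_of_ne _ (p.2.2.trans p'.2.2.symm),
        zero_mul, mul_zero]
      obtain ⟨w, f, hf⟩ := p
      obtain ⟨w', f', hf'⟩ := p'
      intro h
      cases h
      exact hne rfl
    · simp
  refine ⟨?_, ?_⟩
  · change (Λ.q v - S) * (Λ.q v - S) = Λ.q v - S
    rw [mul_sub, sub_mul, sub_mul, h1, h3, h4, q_mul_q_self, sub_self, sub_zero]
  · change star (Λ.q v - S) = Λ.q v - S
    rw [star_sub, h2, star_q]

/-- The weights of the vertex projections are subinvariant under the vertex matrices. -/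
theorem sum_vertexMatrix_mul_le [Fintype V] (hφ : IsKMSState (Λ.dynamics r) β φ) (i : Fin k)
    (v : V) :
    ∑ w, Λ.vertexMatrix i v w * (φ (Λ.q w)).re ≤ Real.exp (β * r i) * (φ (Λ.q v)).re := by
  have hfin := fun w => Λ.finite_paths v w (Pi.single i 1)
  let := fun w => Fintype.ofFinite {f : w ⟶ v // Λ.deg f = Pi.single i 1}
  have h := apply_nonneg_of_isStarProjection hφ.isState
    (isStarProjection_q_sub (Λ := Λ) v (Pi.single i 1))
  have hdeg : ∀ n : Fin k → ℕ, n = Pi.single i 1 → ∑ j, r j * (n j : ℝ) = r i := by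
    rintro _ rfl
    rw [Finset.sum_eq_single i]
    · simp
    · intro j _ hj; simp [hj]
    · simp
  have hsum : φ (∑ p : Σ w : V, {f : w ⟶ v // Λ.deg f = Pi.single i 1},
      Λ.t p.2.1 * star (Λ.t p.2.1)) = ((Real.exp (-(β * r i)) *
        ∑ w, Λ.vertexMatrix i v w * (φ (Λ.q w)).re : ℝ) : ℂ) := by
    rw [map_sum, Fintype.sum_sigma]
    push_cast
    rw [Finset.mul_sum]
    refine Finset.sum_congr rfl fun w _ => ?_
    have : ∀ f : {f : w ⟶ v // Λ.deg f = Pi.single i 1},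
        φ (Λ.t f.1 * star (Λ.t f.1)) = Complex.exp (-(β * r i)) * φ (Λ.q w) := by
      intro f
      rw [apply_t_mul_star_t hφ, hdeg _ f.2]
      push_cast
      rfl
    simp only [this, Finset.sum_const, Finset.card_univ, nsmul_eq_mul]
    rw [ofReal_re_apply_q hφ.isState]
    have hc : (Λ.vertexMatrix i v w : ℂ) =
        (Fintype.card {f : w ⟶ v // Λ.deg f = Pi.single i 1} : ℂ) := by
      rw [vertexMatrix, Complex.ofReal_natCast, ← Nat.card_eq_fintype_card]
      rfl
    rw [hc]
    ring
  rw [map_sub, hsum, sub_nonneg, ← ofReal_re_apply_q hφ.isState] at h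
  have h' := Complex.real_le_real.1 h
  have hm := mul_le_mul_of_nonneg_left h' (Real.exp_pos (β * r i)).le
  rwa [← mul_assoc, ← Real.exp_add, add_neg_cancel, Real.exp_zero, one_mul] at hm

/-- The weight of a vertex vanishes if the weight of a vertex that leads to it does. -/
theorem apply_q_eq_zero_of_hom (hφ : IsKMSState (Λ.dynamics r) β φ) {w v : V} (f : w ⟶ v)
    (h : φ (Λ.q v) = 0) : φ (Λ.q w) = 0 := by
  have h1 := apply_t_mul_star_t hφ f
  -- Since `t_f t_f⋆ ≤ q_v`, the number `φ(q_v) - e^{-β r·d(f)} φ(q_w)` is nonnegative; with `φ(q_v)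
  -- = 0` this forces `φ(q_w) = 0`.
  have hp : IsStarProjection (Λ.q v - Λ.t f * star (Λ.t f)) := by
    have ha : Λ.q v * (Λ.t f * star (Λ.t f)) = Λ.t f * star (Λ.t f) := by
      rw [← mul_assoc, q_mul_t]
    have hb : (Λ.t f * star (Λ.t f)) * Λ.q v = Λ.t f * star (Λ.t f) := by
      have := congrArg star ha
      simpa only [StarMul.star_mul, star_star, star_q] using this
    have hc : (Λ.t f * star (Λ.t f)) * (Λ.t f * star (Λ.t f)) = Λ.t f * star (Λ.t f) := by
      rw [← mul_assoc, Λ.isTCKFamily_t.partialIsometry]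
    refine ⟨?_, ?_⟩
    · change _ * _ = _
      rw [mul_sub, sub_mul, sub_mul, ha, hb, hc, q_mul_q_self, sub_self, sub_zero]
    · change star _ = _
      rw [star_sub, star_q, StarMul.star_mul, star_star]
  have h2 := apply_nonneg_of_isStarProjection hφ.isState hp
  rw [map_sub, h, h1, zero_sub, ← ofReal_re_apply_q hφ.isState, ← Complex.ofReal_mul,
    ← Complex.ofReal_neg] at h2
  have h3 := Complex.zero_le_real.1 h2
  have h4 := apply_q_nonneg hφ.isState w
  rw [← ofReal_re_apply_q hφ.isState] at h4 ⊢
  have h5 := Complex.zero_le_real.1 h4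
  rw [Complex.ofReal_eq_zero]
  nlinarith [Real.exp_pos (-(β * ∑ i, r i * (Λ.deg f i : ℝ)))]

theorem zero_le_vertexMatrix (i : Fin k) (v w : V) : 0 ≤ Λ.vertexMatrix i v w :=
  Nat.cast_nonneg _

/-- Below the critical inverse temperature the vertices of critical components have weight zero. -/
theorem apply_q_eq_zero_of_isCritical (hr : ∀ i, 0 < r i) (hβ : β < 1)
    (hφ : IsKMSState (Λ.dynamics r) β φ) {C : Set V} (hC : Λ.IsCritical r C) {v : V}
    (hv : v ∈ C) : φ (Λ.q v) = 0 := by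
  by_contra hne
  obtain ⟨⟨⟨x, rfl⟩, -⟩, j, -, hj, -⟩ := hC
  have := Λ.finite_vertices
  let := Fintype.ofFinite V
  set C : Set V := {w | Nonempty (w ⟶ x) ∧ Nonempty (x ⟶ w)}
  let := Fintype.ofFinite C
  -- A zero anywhere in `C` would spread along paths inside the component to `v`. Strict positivity
  -- is needed for the subinvariance bound.
  have hpos : ∀ w : C, 0 < (φ (Λ.q w)).re := by
    rintro ⟨w, ⟨a⟩, ⟨b⟩⟩
    refine lt_of_le_of_ne (Complex.zero_le_real.1
      ((ofReal_re_apply_q hφ.isState w).symm ▸ apply_q_nonneg hφ.isState w)) fun h => hne ?_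
    obtain ⟨⟨c⟩, -⟩ := hv
    refine apply_q_eq_zero_of_hom hφ (c ≫ b) ?_
    rw [← ofReal_re_apply_q hφ.isState, ← h, Complex.ofReal_zero]
  have hle : Λ.rhoBlock C j ≤ Real.exp (β * r j) := by
    refine Matrix.rho_le_of_mulVec_le (fun a b => zero_le_vertexMatrix _ _ _) hpos
      (Real.exp_pos _).le fun a => ?_
    -- Dropping the nonnegative terms with `w ∉ C` restricts subinvariance to the block `A_{C,j}`.
    refine le_trans ?_ (sum_vertexMatrix_mul_le hφ j a)
    refine le_trans (le_of_eq ?_) (Finset.sum_le_sum_of_subset_of_nonneg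
      (Finset.subset_univ (Finset.univ.map (Function.Embedding.subtype (· ∈ C)))) fun w _ _ =>
        mul_nonneg (zero_le_vertexMatrix _ _ _) (Complex.nonneg_iff.1
          (apply_q_nonneg hφ.isState w)).1)
    rw [Finset.sum_map]
    rfl
  have hexp : Real.exp (r j) ≤ Λ.rhoBlock C j := by
    rw [hj]
    refine (Real.exp_log ?_).le
    -- `Real.log 0 = 0`, so a vanishing spectral radius would contradict `r_j > 0`.
    refine lt_of_le_of_ne (Matrix.zero_le_rho _) fun h => ?_
    have := hr j
    rw [hj, ← h, Real.log_zero] at this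
    exact lt_irrefl _ this
  have := Real.exp_le_exp.1 (hexp.trans hle)
  nlinarith [hr j]

theorem apply_q_eq_zero_of_mem_hereditaryClosure (hr : ∀ i, 0 < r i) (hβ : β < 1)
    (hφ : IsKMSState (Λ.dynamics r) β φ) {v : V}
    (hv : v ∈ Λ.hereditaryClosure (Λ.minCritVertices r)) : φ (Λ.q v) = 0 := by
  obtain ⟨w, ⟨C, hC, hw⟩, ⟨f⟩⟩ := hv
  exact apply_q_eq_zero_of_hom hφ f (apply_q_eq_zero_of_isCritical hr hβ hφ hC.1 hw)

end Weights

end FinKGraph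

/-! ### The GNS representation on a small Hilbert space -/

section GNS

/-- Conjugation by a unitary operator. -/
noncomputable def LinearIsometryEquiv.conjHom {H K : Type*} [NormedAddCommGroup H]
    [InnerProductSpace ℂ H] [CompleteSpace H] [NormedAddCommGroup K] [InnerProductSpace ℂ K]
    [CompleteSpace K] (U : H ≃ₗᵢ[ℂ] K) : (H →L[ℂ] H) →⋆ₙₐ[ℂ] (K →L[ℂ] K) where
  toFun T := U.conjStarAlgEquiv T
  map_smul' c T := by ext; simp
  map_zero' := by ext; simp
  map_add' := U.conjStarAlgEquiv.map_add'
  map_mul' := U.conjStarAlgEquiv.map_mul'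
  map_star' := U.conjStarAlgEquiv.map_star'

/-- Distinct orthonormal vectors are at distance `√2`, so the balls of radius `1/2` around them are
disjoint, and a separable space has only countably many such balls. -/
theorem Orthonormal.countable {ι E : Type*} [NormedAddCommGroup E] [InnerProductSpace ℂ E]
    [TopologicalSpace.SeparableSpace E] {v : ι → E} (hv : Orthonormal ℂ v) : Countable ι := by
  refine Pairwise.countable_of_isOpen_disjoint (s := fun i => Metric.ball (v i) (1 / 2)) ?_
    (fun i => Metric.isOpen_ball) (fun i => ⟨v i, Metric.mem_ball_self (by norm_num)⟩)
  intro i j hij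
  refine Metric.ball_disjoint_ball ?_
  have h : ‖v i - v j‖ ^ 2 = 2 := by
    rw [@norm_sub_sq ℂ, hv.1, hv.1, hv.2 hij]
    norm_num
  rw [dist_eq_norm]
  nlinarith [norm_nonneg (v i - v j)]

/-- A separable Hilbert space is isometric to `ℓ²(ι)` for an index set `ι` in `Type`. -/
theorem exists_linearIsometryEquiv_lp (E : Type*) [NormedAddCommGroup E] [InnerProductSpace ℂ E]
    [CompleteSpace E] [TopologicalSpace.SeparableSpace E] :
    ∃ ι : Type, Nonempty (E ≃ₗᵢ[ℂ] lp (fun _ : ι => ℂ) 2) := by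
  obtain ⟨w, b, -⟩ := exists_hilbertBasis ℂ E
  have := b.orthonormal.countable
  -- The countable basis is reindexed by a subset of `ℕ`, which brings the index set down to
  -- universe `Type`.
  obtain ⟨f, hf⟩ := exists_injective_nat w
  let e := Equiv.ofInjective f hf
  have ho : Orthonormal ℂ (b ∘ e.symm) := b.orthonormal.comp _ e.symm.injective
  refine ⟨Set.range f, ⟨(HilbertBasis.mk ho ?_).repr⟩⟩
  rw [e.symm.surjective.range_comp]
  exact b.dense_span.ge

variable {A : Type*} [NonUnitalCStarAlgebra A]

/-- A state, as a positive linear map. -/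
def IsState.toPositiveLinearMap [PartialOrder A] [StarOrderedRing A] {φ : A →L[ℂ] ℂ}
    (hφ : IsState φ) : A →ₚ[ℂ] ℂ :=
  PositiveLinearMap.mk₀ φ.toLinearMap fun x hx => by
    rw [StarOrderedRing.nonneg_iff] at hx
    change 0 ≤ φ x
    induction hx using AddSubmonoid.closure_induction with
    | mem x hx => obtain ⟨s, rfl⟩ := hx; exact hφ.nonneg s
    | zero => simp
    | add x y _ _ h1 h2 => rw [map_add]; exact add_nonneg h1 h2

/-- The GNS representation of a state of a separable unital C⋆-algebra. -/
theorem IsState.exists_representation [TopologicalSpace.SeparableSpace A]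
    {φ : A →L[ℂ] ℂ} (hφ : IsState φ) {e : A}
    (hes : star e = e) (hel : ∀ x, e * x = x) (her : ∀ x, x * e = x) :
    ∃ (ι : Type) (ρ : A →⋆ₙₐ[ℂ] (lp (fun _ : ι => ℂ) 2 →L[ℂ] lp (fun _ : ι => ℂ) 2))
      (ξ : lp (fun _ : ι => ℂ) 2), ‖ξ‖ ≤ 1 ∧ (∀ a, φ a = inner ℂ ξ (ρ a ξ)) ∧
        ∀ a, (∀ b, φ (star (a * b) * (a * b)) = 0) → ρ a = 0 := by
  let := CStarAlgebra.spectralOrder A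
  have := CStarAlgebra.spectralOrderedRing A
  let f := hφ.toPositiveLinearMap
  have hf : ∀ a, f a = φ a := fun _ => rfl
  -- Continuity makes the pre-GNS space a continuous image of the separable algebra `A`.
  have hcont : Continuous f.toPreGNS := by
    refine (f.toPreGNS.toLinearMap.mkContinuous 1 fun x => ?_).continuous
    rw [one_mul, ← sq_le_sq₀ (norm_nonneg _) (norm_nonneg _)]
    have h1 := f.preGNS_norm_sq (f.toPreGNS x)
    have h2 := congrArg norm h1
    rw [← Complex.ofReal_pow, Complex.norm_real, Real.norm_of_nonneg (by positivity)] at h2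
    refine h2.le.trans ((φ.le_opNorm _).trans ?_)
    rw [hφ.norm_eq_one, one_mul, PositiveLinearMap.ofPreGNS_toPreGNS,
      CStarRing.norm_star_mul_self, sq]
  have : TopologicalSpace.SeparableSpace f.PreGNS :=
    f.toPreGNS.surjective.denseRange.separableSpace hcont
  obtain ⟨ι, ⟨U⟩⟩ := exists_linearIsometryEquiv_lp f.GNS
  -- The class of the unit `e` is the vector that implements `φ`.
  let η : f.GNS := (f.toPreGNS e : f.PreGNS)
  have hη : ∀ a, φ a = inner ℂ η (f.gnsNonUnitalStarAlgHom a η) := by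
    intro a
    rw [PositiveLinearMap.gnsNonUnitalStarAlgHom_apply_coe, UniformSpace.Completion.inner_coe,
      PositiveLinearMap.preGNS_inner_def]
    simp [hes, hel, her, hf]
  have hηn : ‖η‖ ≤ 1 := by
    have h1 : ‖e‖ ≤ 1 := by
      have : ‖star e * e‖ = ‖e‖ * ‖e‖ := CStarRing.norm_star_mul_self
      rw [hes, hel] at this
      nlinarith [norm_nonneg e]
    have h2 : ‖η‖ ^ 2 ≤ 1 := by
      have h3 := f.preGNS_norm_sq (f.toPreGNS e)
      have h2 := congrArg norm h3
      rw [← Complex.ofReal_pow, Complex.norm_real, Real.norm_of_nonneg (by positivity)] at h2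
      rw [UniformSpace.Completion.norm_coe, h2]
      refine (φ.le_opNorm _).trans ?_
      rw [hφ.norm_eq_one, one_mul, PositiveLinearMap.ofPreGNS_toPreGNS, hes, hel]
      exact h1
    nlinarith [norm_nonneg η]
  refine ⟨ι, U.conjHom.comp f.gnsNonUnitalStarAlgHom, U η,
    by rwa [U.norm_map], fun a => ?_, fun a ha => ?_⟩
  · change φ a = inner ℂ (U η) (U (f.gnsNonUnitalStarAlgHom a (U.symm (U η))))
    rw [U.symm_apply_apply, U.inner_map_map, hη]
  · have h0 : f.gnsNonUnitalStarAlgHom a = 0 := by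
      ext x
      induction x using UniformSpace.Completion.induction_on with
      | hp => exact isClosed_eq (f.gnsNonUnitalStarAlgHom a).continuous continuous_const
      | ih x =>
        rw [PositiveLinearMap.gnsNonUnitalStarAlgHom_apply_coe, zero_apply,
          ← norm_eq_zero, UniformSpace.Completion.norm_coe]
        have h1 := f.preGNS_norm_sq (f.leftMulMapPreGNS a x)
        have h2 : (‖f.leftMulMapPreGNS a x‖ : ℂ) ^ 2 = 0 := h1.trans (ha (f.ofPreGNS x))
        exact_mod_cast pow_eq_zero_iff two_ne_zero |>.1 h2
    rw [NonUnitalStarAlgHom.comp_apply, h0, map_zero]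

/-- Cauchy–Schwarz: `|φ(xq)|² ≤ φ(xx⋆) φ(q⋆q)`. -/
theorem IsState.apply_mul_eq_zero {φ : A →L[ℂ] ℂ}
    (hφ : IsState φ) {q : A} (hq : φ (star q * q) = 0) (x : A) : φ (x * q) = 0 := by
  let := CStarAlgebra.spectralOrder A
  have := CStarAlgebra.spectralOrderedRing A
  let f := hφ.toPositiveLinearMap
  have h1 := f.preGNS_norm_sq (f.toPreGNS q)
  have h2 : (‖f.toPreGNS q‖ : ℂ) ^ 2 = 0 := h1.trans hq
  have h3 : ‖f.toPreGNS q‖ = 0 := by exact_mod_cast pow_eq_zero_iff two_ne_zero |>.1 h2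
  have h4 := norm_inner_le_norm (𝕜 := ℂ) (f.toPreGNS (star x)) (f.toPreGNS q)
  rw [h3, mul_zero, f.preGNS_inner_def] at h4
  rw [PositiveLinearMap.ofPreGNS_toPreGNS, star_star] at h4
  exact norm_le_zero_iff.1 h4

end GNS

namespace FinKGraph

variable {k : ℕ} {V : Type u} [Category.{v} V] {Λ : FinKGraph k V}

/-! ### Factoring a KMS state through the quotient -/

/-- For `x = t_f t_g⋆` the KMS condition moves `x` to the left, up to a nonzero scalar, and
Cauchy–Schwarz kills `φ(x y q_v)`; density gives all `x`. This two-sided vanishing is what makes the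
GNS representation kill `q_v`. -/
theorem apply_mul_q_mul_eq_zero {r : Fin k → ℝ} {β : ℝ} {φ : Λ.Toeplitz →L[ℂ] ℂ}
    (hφ : IsKMSState (Λ.dynamics r) β φ) {v : V} (hv : φ (Λ.q v) = 0) (y x : Λ.Toeplitz) :
    φ (y * Λ.q v * x) = 0 := by
  have hq : φ (star (Λ.q v) * Λ.q v) = 0 := by rw [star_q, q_mul_q_self, hv]
  refine DFunLike.congr_fun (clm_ext (φ := φ.comp (ContinuousLinearMap.mul ℂ _ (y * Λ.q v)))
    (ψ := 0) fun p => ?_) x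
  have h := apply_tt_mul_of_isKMSState hφ p (y * Λ.q v)
  rw [← mul_assoc, hφ.isState.apply_mul_eq_zero hq] at h
  exact (mul_eq_zero.1 h.symm).resolve_left (Complex.exp_ne_zero _)

/-- A family of `Λ` that vanishes on the paths with source in `X` restricts to a family of
`Λ \ X`. -/
theorem IsTCKFamily.restrict {B : Type*} [NonUnitalCStarAlgebra B]
    {T : ∀ ⦃w v : V⦄, (w ⟶ v) → B} (h : Λ.IsTCKFamily T) {X : Set V} (hX : Λ.IsHereditary X)
    (h0 : ∀ ⦃w v : V⦄ (f : w ⟶ v), w ∈ X → T f = 0) :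
    (Λ.remove X hX).IsTCKFamily fun _ _ f => T f.hom where
  partialIsometry _ _ f := h.partialIsometry f.hom
  projection v := h.projection v.obj
  orthogonal v w hvw := h.orthogonal v.obj w.obj fun e => hvw (ObjectProperty.FullSubcategory.ext e)
  mul _ _ _ f g := h.mul f.hom g.hom
  star_mul x y v f g := by
    refine (h.star_mul f.hom g.hom).trans ?_
    let F : (Λ.remove X hX).MinExt f g → Λ.MinExt f.hom g.hom := fun p =>
      ⟨⟨p.1.1.obj, p.1.2.1.hom, p.1.2.2.hom⟩,
        congrArg InducedCategory.Hom.hom p.2.1, p.2.2⟩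
    have hF : Function.Injective F := by
      rintro ⟨⟨⟨z, _⟩, ⟨a⟩, ⟨b⟩⟩, h⟩ ⟨⟨⟨z', _⟩, ⟨a'⟩, ⟨b'⟩⟩, h'⟩ e
      cases e
      rfl
    have hsupp : Function.support (fun p : Λ.MinExt f.hom g.hom =>
        T p.1.2.1 * star (T p.1.2.2)) ⊆ Set.range F := by
      -- Minimal extensions whose source lies in `X` contribute zero; the others are exactly those
      -- of the smaller graph.
      rintro ⟨⟨z, a, b⟩, hp⟩ hne
      have hz : z ∉ X := fun hz => hne (by simp [h0 a hz])
      exact ⟨⟨⟨⟨z, hz⟩, ⟨a⟩, ⟨b⟩⟩, ObjectProperty.hom_ext _ hp.1, hp.2⟩, rfl⟩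
    rw [← finsum_mem_univ (fun p : Λ.MinExt f.hom g.hom => T p.1.2.1 * star (T p.1.2.2)),
      finsum_mem_inter_support_eq _ Set.univ (Set.range F)
        (by rw [Set.univ_inter, Set.inter_eq_right.2 hsupp]),
      finsum_mem_range hF]
  star_mul_of_ne _ _ _ _ f g hvw :=
    h.star_mul_of_ne f.hom g.hom fun e => hvw (ObjectProperty.FullSubcategory.ext e)

/-- A KMS state that vanishes on the vertices of a hereditary set factors through the quotient
by it. -/
theorem exists_isKMSState_quotient {r : Fin k → ℝ} {β : ℝ} {φ : Λ.Toeplitz →L[ℂ] ℂ}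
    (hφ : IsKMSState (Λ.dynamics r) β φ) {X : Set V} (hX : Λ.IsHereditary X)
    (hq : ∀ v ∈ X, φ (Λ.q v) = 0) :
    ∃ ψ : (Λ.remove X hX).Toeplitz →L[ℂ] ℂ,
      IsKMSState ((Λ.remove X hX).dynamics r) β ψ ∧ ∀ a, φ a = ψ (Λ.quotientMap X hX a) := by
  obtain ⟨ι, ρ, ξ, hξ, hρ, hker⟩ :=
    hφ.isState.exists_representation Λ.star_unit Λ.unit_mul Λ.mul_unit
  have hρt : ∀ ⦃w v : V⦄ (f : w ⟶ v), w ∈ X → ρ (Λ.t f) = 0 := by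
    intro w v f hw
    rw [← t_mul_q, map_mul, hker (Λ.q w), mul_zero]
    intro b
    rw [StarMul.star_mul, star_q, mul_assoc, ← mul_assoc (Λ.q w), q_mul_q_self, ← mul_assoc]
    exact apply_mul_q_mul_eq_zero hφ (hq w hw) _ _
  let R : (Λ.remove X hX).TCKRep :=
    ⟨lp (fun _ : ι => ℂ) 2 →L[ℂ] lp (fun _ : ι => ℂ) 2, fun _ _ f => ρ (Λ.t f.hom),
      (Λ.isTCKFamily_t.map ρ).restrict hX hρt⟩
  let σ : (Λ.remove X hX).Toeplitz →⋆ₙₐ[ℂ]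
    (lp (fun _ : ι => ℂ) 2 →L[ℂ] lp (fun _ : ι => ℂ) 2) := (Λ.remove X hX).eval R
  have hσρ : σ.comp (Λ.quotientMap X hX) = ρ := by
    refine toeplitz_hom_ext fun w v f => ?_
    rw [NonUnitalStarAlgHom.comp_apply, quotientMap, lift_t]
    by_cases hw : w ∈ X
    · rw [quotFamily_of_mem _ _ _ _ hw, map_zero, hρt f hw]
    · rw [quotFamily, dif_pos hw]
      rfl
  have hσc : Continuous σ := map_continuous σ
  let ψ : (Λ.remove X hX).Toeplitz →L[ℂ] ℂ := (innerSL ℂ ξ).comp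
    ((ContinuousLinearMap.apply ℂ (lp (fun _ : ι => ℂ) 2) ξ).comp (⟨(σ : _ →ₗ[ℂ] _), hσc⟩ :
      _ →L[ℂ] (lp (fun _ : ι => ℂ) 2 →L[ℂ] lp (fun _ : ι => ℂ) 2)))
  have hψ : ∀ y, ψ y = inner ℂ ξ (σ y ξ) := fun _ => rfl
  have hfac : ∀ a, φ a = ψ (Λ.quotientMap X hX a) := by
    intro a
    rw [hρ, hψ, ← hσρ]
    rfl
  have hstate : IsState ψ := by
    refine ⟨fun a => ?_, le_antisymm ?_ ?_⟩
    · rw [hψ, map_mul, map_star, mul_apply_eq_comp, ContinuousLinearMap.star_eq_adjoint,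
        ContinuousLinearMap.adjoint_inner_right, inner_self_eq_norm_sq_to_K, ← RCLike.ofReal_pow]
      exact Complex.zero_le_real.2 (sq_nonneg ‖σ a ξ‖)
    · refine ψ.opNorm_le_bound zero_le_one fun a => ?_
      rw [hψ, one_mul]
      have h1 := NonUnitalStarAlgHom.norm_apply_le σ a
      have h2 := (σ a).le_opNorm ξ
      have h3 := norm_inner_le_norm (𝕜 := ℂ) ξ (σ a ξ)
      have h4 : ‖σ a ξ‖ ≤ ‖a‖ :=
        h2.trans ((mul_le_of_le_one_right (norm_nonneg _) hξ).trans h1)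
      exact h3.trans ((mul_le_of_le_one_left (norm_nonneg _) hξ).trans h4)
    -- `φ` is `ψ` composed with a contraction, so `1 = ‖φ‖ ≤ ‖ψ‖`.
    · rw [← hφ.isState.norm_eq_one]
      refine φ.opNorm_le_bound (norm_nonneg _) fun a => ?_
      rw [hfac]
      exact (ψ.le_opNorm _).trans (mul_le_mul_of_nonneg_left
        (NonUnitalStarAlgHom.norm_apply_le _ a) (norm_nonneg _))
  refine ⟨ψ, isKMSState_of_forall_tt hstate fun p p' => ?_, hfac⟩
  -- Spanning elements of the quotient lift to spanning elements of the same weight, so the KMS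
  -- identity for `φ` descends.
  let L : (Λ.remove X hX).PathPair → Λ.PathPair := fun p =>
    ⟨p.1.obj, p.2.1.obj, p.2.2.1.obj, p.2.2.2.1.hom, p.2.2.2.2.hom⟩
  have hL : ∀ p, Λ.quotientMap X hX (Λ.tt (L p)) = (Λ.remove X hX).tt p := by
    intro p
    simp only [tt, quotientMap, map_mul, map_star, lift_t, L, quotFamily_coe]
  have := apply_tt_mul_of_isKMSState hφ (L p) (Λ.tt (L p'))
  rw [hfac, hfac, map_mul (Λ.quotientMap X hX), map_mul (Λ.quotientMap X hX), hL, hL] at this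
  exact this

end FinKGraph

namespace FinKGraph

variable {k : ℕ} {V : Type u} [Category.{v} V] {Λ : FinKGraph k V}

/-! ### Critical components -/

theorem IsComponent.eq_of_leads {C D : Set V} (hC : Λ.IsComponent C) (hD : Λ.IsComponent D)
    (h1 : Λ.Leads C D) (h2 : Λ.Leads D C) : C = D := by
  obtain ⟨x, rfl⟩ := hC
  obtain ⟨y, rfl⟩ := hD
  obtain ⟨a, ⟨⟨a1⟩, -⟩, b, ⟨-, ⟨b2⟩⟩, ⟨f⟩⟩ := h1
  obtain ⟨c, ⟨⟨c1⟩, -⟩, d, ⟨-, ⟨d2⟩⟩, ⟨g⟩⟩ := h2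
  have p : y ⟶ x := b2 ≫ f ≫ a1
  have q : x ⟶ y := d2 ≫ g ≫ c1
  ext w
  exact ⟨fun ⟨⟨s⟩, ⟨t⟩⟩ => ⟨⟨s ≫ q⟩, ⟨p ≫ t⟩⟩, fun ⟨⟨s⟩, ⟨t⟩⟩ => ⟨⟨s ≫ p⟩, ⟨q ≫ t⟩⟩⟩

theorem IsComponent.nonempty_hom {C : Set V} (hC : Λ.IsComponent C) {v w : V} (hv : v ∈ C)
    (hw : w ∈ C) : Nonempty (w ⟶ v) := by
  obtain ⟨x, rfl⟩ := hC
  obtain ⟨-, ⟨a⟩⟩ := hv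
  obtain ⟨⟨b⟩, -⟩ := hw
  exact ⟨b ≫ a⟩

theorem IsComponent.nonempty {C : Set V} (hC : Λ.IsComponent C) : C.Nonempty := by
  obtain ⟨x, rfl⟩ := hC
  exact ⟨x, ⟨𝟙 x⟩, ⟨𝟙 x⟩⟩

/-- Every critical component lies above a minimal critical component. -/
theorem IsCritical.exists_isMinCritical_leads {r : Fin k → ℝ} {C : Set V}
    (hC : Λ.IsCritical r C) : ∃ D, Λ.IsMinCritical r D ∧ Λ.Leads D C := by
  have := Λ.finite_vertices
  obtain ⟨c, hc⟩ := hC.1.1.nonempty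
  -- A component that leads to `D` has a hereditary closure at least as large, so among the critical
  -- components leading to `C` one with the largest closure is minimal.
  obtain ⟨D, ⟨hD, hDC⟩, hmax⟩ := Set.exists_max_image
    {D | Λ.IsCritical r D ∧ Λ.Leads D C} (fun D => (Λ.hereditaryClosure D).ncard)
    (Set.toFinite _) ⟨C, hC, c, hc, c, hc, ⟨𝟙 c⟩⟩
  refine ⟨D, ⟨hD, fun E hE hED => ?_⟩, hDC⟩
  have hsub : Λ.hereditaryClosure D ⊆ Λ.hereditaryClosure E := by
    rintro w ⟨d, hd, ⟨f⟩⟩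
    obtain ⟨e, he, d', hd', ⟨g⟩⟩ := hED
    obtain ⟨a⟩ := hD.1.1.nonempty_hom hd' hd
    exact ⟨e, he, ⟨f ≫ a ≫ g⟩⟩
  have hEC : Λ.Leads E C := by
    obtain ⟨d, hd, c, hc, ⟨f⟩⟩ := hDC
    obtain ⟨e, he, ⟨g⟩⟩ := hsub ⟨d, hd, ⟨f⟩⟩
    exact ⟨e, he, c, hc, ⟨g⟩⟩
  have heq := Set.eq_of_subset_of_ncard_le hsub (hmax E ⟨hE, hEC⟩) (Set.toFinite _)
  obtain ⟨e, he⟩ := hE.1.1.nonempty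
  have hmem : e ∈ Λ.hereditaryClosure D := heq ▸ ⟨e, he, ⟨𝟙 e⟩⟩
  obtain ⟨d, hd, f⟩ := hmem
  exact hE.1.1.eq_of_leads hD.1.1 hED ⟨d, hd, e, he, f⟩

theorem removed_obj_injective (H : Set V) :
    Function.Injective (ObjectProperty.FullSubcategory.obj : Removed H → V) :=
  fun _ _ h => ObjectProperty.FullSubcategory.ext h

theorem vertexMatrix_remove {H : Set V} (hH : Λ.IsHereditary H) (i : Fin k) :
    (Λ.remove H hH).vertexMatrix i = (Λ.vertexMatrix i).submatrix
      ObjectProperty.FullSubcategory.obj ObjectProperty.FullSubcategory.obj := by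
  ext v w
  refine congrArg Nat.cast (Set.ncard_congr (fun f _ => f.hom) (fun f hf => hf)
    (fun f g _ _ h => ObjectProperty.hom_ext _ h) fun f hf => ⟨ObjectProperty.homMk f, hf, rfl⟩)

theorem rho_remove_le {H : Set V} (hH : Λ.IsHereditary H) (i : Fin k) :
    (Λ.remove H hH).rho i ≤ Λ.rho i := by
  have := Λ.finite_vertices
  have := (Λ.remove H hH).finite_vertices
  rw [rho, rho, vertexMatrix_remove]
  exact Matrix.rho_submatrix_le (zero_le_vertexMatrix i) (removed_obj_injective H)

/-- The two blocks differ by a bijection of index sets, so each is a principal submatrix of the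
other and `Matrix.rho_submatrix_le` applies in both directions. -/
theorem rhoBlock_remove {H : Set V} (hH : Λ.IsHereditary H) (C : Set (Removed H)) (i : Fin k) :
    (Λ.remove H hH).rhoBlock C i =
      Λ.rhoBlock (ObjectProperty.FullSubcategory.obj '' C) i := by
  have := Λ.finite_vertices
  have := (Λ.remove H hH).finite_vertices
  let e := Equiv.Set.image _ C (removed_obj_injective H)
  have h1 : (Λ.remove H hH).blockMatrix C i =
      (Λ.blockMatrix (ObjectProperty.FullSubcategory.obj '' C) i).submatrix e e := by
    rw [blockMatrix, vertexMatrix_remove]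
    rfl
  have h2 : Λ.blockMatrix (ObjectProperty.FullSubcategory.obj '' C) i =
      ((Λ.remove H hH).blockMatrix C i).submatrix e.symm e.symm := by
    rw [h1, Matrix.submatrix_submatrix, e.self_comp_symm, Matrix.submatrix_id_id]
  refine le_antisymm ?_ ?_
  · rw [rhoBlock, h1]
    exact Matrix.rho_submatrix_le (fun _ _ => zero_le_vertexMatrix _ _ _) e.injective
  · rw [rhoBlock, h2]
    exact Matrix.rho_submatrix_le (fun _ _ => zero_le_vertexMatrix _ _ _) e.symm.injective

theorem IsComponent.of_remove {H : Set V} (hH : Λ.IsHereditary H) {C : Set (Removed H)}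
    (hC : (Λ.remove H hH).IsComponent C) :
    Λ.IsComponent (ObjectProperty.FullSubcategory.obj '' C) := by
  obtain ⟨x, rfl⟩ := hC
  refine ⟨x.obj, Set.ext fun w => ⟨?_, ?_⟩⟩
  · rintro ⟨w, ⟨⟨f⟩, ⟨g⟩⟩, rfl⟩
    exact ⟨⟨f.hom⟩, ⟨g.hom⟩⟩
  · rintro ⟨⟨f⟩, ⟨g⟩⟩
    exact ⟨⟨w, fun hw => x.2 (hH hw ⟨g⟩)⟩,
      ⟨⟨ObjectProperty.homMk f⟩, ⟨ObjectProperty.homMk g⟩⟩, rfl⟩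

/-- A critical component that remains after the removal of a hereditary set is critical. -/
theorem IsCritical.of_remove (h1 : Λ.A1) (h2 : Λ.A2) {r : Fin k → ℝ} (hr : ∀ i, 0 < r i)
    (hnorm : Λ.IsNormalised r) {H : Set V} (hH : Λ.IsHereditary H) {C : Set (Removed H)}
    (hC : (Λ.remove H hH).IsCritical r C) :
    Λ.IsCritical r (ObjectProperty.FullSubcategory.obj '' C) := by
  obtain ⟨⟨hcomp, -⟩, j, hj, hrj, -⟩ := hC
  have hcomp' := hcomp.of_remove hH
  have hmem : ObjectProperty.FullSubcategory.obj '' C ∈ Λ.components := ⟨hcomp', h1.1 _ hcomp'⟩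
  -- The normalisation bounds the value for `Λ` above by `1`; it is at least the value for the
  -- subgraph, which is `1`.
  refine ⟨hmem, j, le_antisymm (hnorm.2 ⟨j, rfl⟩) ?_, by rw [hrj, rhoBlock_remove],
    (h2 _ hmem).1 j⟩
  rw [← hj]
  have hfin := (Λ.remove H hH).finite_vertices
  refine mul_le_mul_of_nonneg_left (Real.log_le_log ?_ (rho_remove_le hH j)) (inv_pos.2 (hr j)).le
  refine lt_of_le_of_ne (ENNReal.toReal_nonneg) fun h => ?_
  rw [← h, Real.log_zero, mul_zero] at hj
  exact zero_ne_one hj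

/-- A minimal critical component leads to `C`, so the vertices of `C` lie in the hereditary closure
of `M`; they are outside `H`, which is that closure without `M`. -/
theorem setG_subset_minCritVertices (h1 : Λ.A1) (h2 : Λ.A2) {r : Fin k → ℝ} (hr : ∀ i, 0 < r i)
    (hnorm : Λ.IsNormalised r) : Λ.setG r ⊆ Λ.minCritVertices r := by
  rintro _ ⟨v, ⟨C, hC, hv⟩, rfl⟩
  have hC' := hC.of_remove h1 h2 hr hnorm
  obtain ⟨D, hD, d, hd, c, hc, ⟨f⟩⟩ := hC'.exists_isMinCritical_leads
  obtain ⟨g⟩ := hC'.1.1.nonempty_hom hc (Set.mem_image_of_mem _ hv)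
  by_contra hne
  exact v.2 ⟨⟨d, ⟨D, hD, hd⟩, ⟨g ≫ f⟩⟩, hne⟩

theorem setH_union_setG_subset (h1 : Λ.A1) (h2 : Λ.A2) {r : Fin k → ℝ} (hr : ∀ i, 0 < r i)
    (hnorm : Λ.IsNormalised r) :
    Λ.setH r ∪ Λ.setG r ⊆ Λ.hereditaryClosure (Λ.minCritVertices r) :=
  Set.union_subset Set.sdiff_subset
    fun v hv => ⟨v, setG_subset_minCritVertices h1 h2 hr hnorm hv, ⟨𝟙 v⟩⟩

theorem isHereditary_setH_union_setG (h1 : Λ.A1) (h2 : Λ.A2) {r : Fin k → ℝ}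
    (hr : ∀ i, 0 < r i) (hnorm : Λ.IsNormalised r) :
    Λ.IsHereditary (Λ.setH r ∪ Λ.setG r) := by
  rintro v w (hv | hv) ⟨f⟩
  · exact Or.inl (Λ.isHereditary_setH r hv ⟨f⟩)
  · have hvM := setG_subset_minCritVertices h1 h2 hr hnorm hv
    by_cases hwM : w ∈ Λ.minCritVertices r
    · obtain ⟨v, ⟨C, hC, hv⟩, rfl⟩ := hv
      have hC' := hC.of_remove h1 h2 hr hnorm
      obtain ⟨D, hD, hwD⟩ := hwM
      -- The path exhibits a critical component leading to the minimal component `D` of `w`, so the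
      -- two coincide and `w` stays in `G`.
      have hCD := hD.2 _ hC' ⟨_, Set.mem_image_of_mem _ hv, w, hwD, ⟨f⟩⟩
      rw [← hCD] at hwD
      obtain ⟨w, hw, rfl⟩ := hwD
      exact Or.inr ⟨w, ⟨C, hC, hw⟩, rfl⟩
    · exact Or.inl ⟨⟨v, hvM, ⟨f⟩⟩, hwM⟩

end FinKGraph

theorem mainTheorem12 {k : ℕ} {V : Type u} [Category.{v} V] (Λ : FinKGraph k V)
    (hΛ : Λ.NoSourcesNoSinks) (h1 : Λ.A1) (h2 : Λ.A2) (h3 : Λ.A3)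
    (r : Fin k → ℝ) (hr : ∀ i, 0 < r i) (hind : LinearIndependent ℚ r)
    (hnorm : Λ.IsNormalised r) (β : ℝ) (hβ : β < 1) :
    ∃ hX : Λ.IsHereditary (Λ.setH r ∪ Λ.setG r),
      ∀ φ : Λ.Toeplitz →L[ℂ] ℂ, IsKMSState (Λ.dynamics r) β φ →
        (∀ v ∈ Λ.setH r ∪ Λ.setG r, φ (Λ.q v) = 0) ∧
        ∃ ψ : (Λ.remove (Λ.setH r ∪ Λ.setG r) hX).Toeplitz →L[ℂ] ℂ,
          IsKMSState ((Λ.remove (Λ.setH r ∪ Λ.setG r) hX).dynamics r) β ψ ∧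
          ∀ a, φ a = ψ (Λ.quotientMap (Λ.setH r ∪ Λ.setG r) hX a) := by
  refine ⟨FinKGraph.isHereditary_setH_union_setG h1 h2 hr hnorm, fun φ hφ => ?_⟩
  have hq : ∀ v ∈ Λ.setH r ∪ Λ.setG r, φ (Λ.q v) = 0 := fun v hv =>
    FinKGraph.apply_q_eq_zero_of_mem_hereditaryClosure hr hβ hφ
      (FinKGraph.setH_union_setG_subset h1 h2 hr hnorm hv)
  exact ⟨hq, FinKGraph.exists_isKMSState_quotient hφ _ hq⟩
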